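/- **Setting.** Let $G=(V,E)$ be a finite simple graph with a 1-plane embedding $\gamma=(\chi,\rho,\varphi)$: the embedding induced by a drawing of $G$ in the plane in which every edge has at most one crossing and crossing edges have no common end, where $\chi$ is the set of pairs of crossing edges (also identified with the crossing points), $\rho$ is the rotation system and $\varphi$ is the outer face. Its planarization $\mathcal G=\mathcal G(G,\gamma)$ is the plane graph on $V\cup\chi$ obtained by regarding crossings as vertices. Assume that $(G,\gamma)$ is circular: for each crossing $c$ of edges $u_1u_3$ and $u_2u_4$ there are vertices $w_1,\dots,w_4$ of degree $2$ in $G$ such that $(u_1,w_1,u_2,w_2,u_3,w_3,u_4,w_4)$ is a cycle of crossing-free edges of $G$. A cross-preserving embedding $\gamma'$ of $\gamma$ is a 1-plane embedding of $G$ with the same set $\chi$ of crossing pairs; equivalently, another plane embedding of the graph $\mathcal G$ in which the alternating order of the edges around each crossing is preserved. An embedding is straight-line drawable (SLD) if it is induced by a straight-line drawing of $G$. The interior and the exterior of a simple cycle of $\mathcal G$ are the two sides of it, the exterior being the one that contains the outer face; a vertex is in the interior or the exterior only if it is not on the cycle. Let $C=(u,c,v,s)$ be a cycle of $\mathcal G$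 with $u,v\in V$ and $c,s\in\chi$. * $C$ is a *posi-cycle* if (1) its interior contains neither a crossing-free edge $uv$ of $G$ nor a crossing adjacent to both $u$ and $v$; (2) its exterior contains no vertex in $V\setminus\{u,v\}$ adjacent to $c$ or $s$ (W-cycle) or exactly one such vertex (B-cycle); and (3) no face in its interior has both $u$ and $v$ on its boundary. * $C$ is a *nega-cycle* if (1') its exterior contains neither a crossing-free edge $uv$ of $G$ nor a crossing adjacent to both $u$ and $v$; (2') its interior contains at most one vertex in $V\setminus\{u,v\}$ adjacent to $c$ or $s$; and (3') no face in its exterior has both $u$ and $v$ on its boundary. * A vertex $z\in V$ is an *in-factor* of a posi-cycle (resp. nega-cycle) $C$ if $\mathcal G$ has a path from $z$ to $u$ and a path from $z$ to $v$ such that all vertices of the first path except $u$, and all vertices of the second except $v$, are in the exterior (resp. interior) of $C$. * $\{C,C'\}$ with $C=(u,c,v,s)$ and $C'=(u',c',v',s')$ is a *forbidden cycle pair* if $C$ is a posi-cycle, and either $C'$ is a posi-cycle such that no face is in the interior of both $C$ and $C'$, or $C'$ is a nega-cycle such that every face in the interior of $C$ is in the interior of $C'$; and $\mathcal G$ has a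 path $P_1$ from $u$ to $u'$ and a path $P_2$ from $v$ to $v'$ (possibly a single vertex, and not necessarily disjoint) such that all vertices of $V(P_1)\setminus\{u\}$ and of $V(P_2)\setminus\{v\}$ are in the exterior of $C$, and all vertices of $V(P_1)\setminus\{u'\}$ and of $V(P_2)\setminus\{v'\}$ are in the exterior of $C'$ if $C'$ is the posi-cycle of the first case, and in the interior of $C'$ if $C'$ is the nega-cycle of the second case. * A *B-configuration* consists of edges $u_1u_2,u_2u_3,u_3u_4$ of $G$ such that $u_1u_2$ and $u_3u_4$ cross, at $c$ say, and $u_1$ and $u_4$ are in the interior of the closed curve formed by the part of $u_1u_2$ from $u_2$ to $c$, the part of $u_3u_4$ from $c$ to $u_3$, and the edge $u_2u_3$ (which may have a crossing). A *W-configuration* consists of edges $u_1u_2,u_2u_3,v_1v_2,v_2v_3$ of $G$ such that $u_1u_2$ and $v_2v_3$ cross at $c$, $u_2u_3$ and $v_1v_2$ cross at $s\ne c$, and $u_1,u_3,v_1,v_3$ are in the interior of the cycle $(u_2,c,v_2,s)$. **Lemma.** (i) Let $z\in V$ be an in-factor of a posi- or nega-cycle $C$ in $\gamma$, and let $\gamma'$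 be a cross-preserving embedding of $\gamma$. Then $C$ is a posi-cycle in $\gamma'$ if and only if $z$ is in the exterior of $C$ in $\gamma'$, and $C$ is a nega-cycle in $\gamma'$ if and only if $z$ is in the interior of $C$ in $\gamma'$. (ii) Let $\{C,C'\}$ be a forbidden cycle pair in $\gamma$. Then in every cross-preserving embedding $\gamma'$ of $\gamma$ at least one of $C$ and $C'$ is a posi-cycle; hence every cross-preserving embedding of $\gamma$ contains a B- or W-configuration, and $(G,\gamma)$ admits no SLD cross-preserving embedding. -/

import Mathlib

namespace OnePlane

universe u

/-! ### Plane embeddings of finite simple graphs -/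

/-- A plane embedding of a (finite, possibly disconnected) simple graph, given by a rotation
system, the faces, and the choice of an outer face.

* `rot d` is the dart that follows `d` in the counterclockwise order around the tail of `d`;
  the darts with a given tail form one cycle.
* `left d` is the face on the left hand side of the dart `d`; the sector between `d` and `rot d`
  lies on the left of `d` and on the right of `rot d`.
* an isolated vertex lies inside the face `isoFace`.
* the embedding is planar: the faces are connected with each other across edges, and Euler's formula
  `|V| - |E| + |F| = 1 + (number of connected components)` holds. For a connected graph this
  says that the faces are exactly the orbits of the face traversal and that the genus is `0`. For a
  disconnected graph it says that every component has genus `0` and that the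
  components are placed into faces of each other consistently (their incidence graph
  with the faces is a tree). -/
structure PlaneEmbedding {W : Type u} (H : SimpleGraph W) where
  rot : Equiv.Perm H.Dart
  rot_fst : ∀ d, (rot d).fst = d.fst
  rot_cyclic : ∀ d d' : H.Dart, d.fst = d'.fst → rot.SameCycle d d'
  Face : Type
  left : H.Dart → Face
  left_rot : ∀ d, left (rot d).symm = left d
  isoFace : ∀ w, (∀ w', ¬ H.Adj w w') → Face
  dual_connected : ∀ f g : Face,
    Relation.ReflTransGen (fun a b => ∃ d : H.Dart, left d = a ∧ left d.symm = b) f g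
  euler : Nat.card W + Nat.card Face =
    Nat.card H.edgeSet + Nat.card H.ConnectedComponent + 1
  outer : Face

namespace PlaneEmbedding

variable {W : Type u} {H : SimpleGraph W} (E : PlaneEmbedding H)

/-- The vertex `w` lies on the boundary of the face `f`. -/
def Incident (w : W) (f : E.Face) : Prop :=
  (∃ d : H.Dart, d.fst = w ∧ E.left d = f) ∨
    ∃ h : ∀ w', ¬ H.Adj w w', E.isoFace w h = f

/-- The faces in the exterior of the cycle with edge set `K`: those that are reached from the
outer face without crossing an edge of `K`. -/
def extFaces (K : Set (Sym2 W)) : Set E.Face :=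
  {f | Relation.ReflTransGen
    (fun a b => ∃ d : H.Dart, d.edge ∉ K ∧ E.left d = a ∧ E.left d.symm = b) E.outer f}

/-- The faces in the interior of the cycle with edge set `K`. -/
def intFaces (K : Set (Sym2 W)) : Set E.Face := (E.extFaces K)ᶜ

/-- The vertex `w` is not on the cycle with edge set `K` and lies in the region formed by the
faces in `S` (in the uses below, `S` consists of the faces on one side of the cycle). -/
def VertexIn (K : Set (Sym2 W)) (S : Set E.Face) (w : W) : Prop :=
  (∀ e ∈ K, w ∉ e) ∧ ∀ f, E.Incident w f → f ∈ S

/-- The vertex `w` lies in the exterior of the cycle with edge set `K`. -/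
def VertexExt (K : Set (Sym2 W)) (w : W) : Prop := E.VertexIn K (E.extFaces K) w

/-- The vertex `w` lies in the interior of the cycle with edge set `K`. -/
def VertexInt (K : Set (Sym2 W)) (w : W) : Prop := E.VertexIn K (E.intFaces K) w

end PlaneEmbedding

/-! ### 1-plane embeddings -/

variable {V : Type u} {G : SimpleGraph V}

/-- A crossing system of `G`: the set of the pairs of edges that cross. Crossing edges have
no end in common, and every edge has at most one crossing. -/
structure CrossingSystem (G : SimpleGraph V) where
  pairs : Set (Sym2 (Sym2 V))
  edge_mem : ∀ p ∈ pairs, ∀ e ∈ p, e ∈ G.edgeSet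
  disjoint : ∀ e e', s(e, e') ∈ pairs → ∀ x ∈ e, x ∉ e'
  unique : ∀ p ∈ pairs, ∀ q ∈ pairs, ∀ e, e ∈ p → e ∈ q → p = q

namespace CrossingSystem

/-- The crossings, which become vertices of the planarization. -/
abbrev Crossing (X : CrossingSystem G) : Type u := X.pairs

/-- The graph underlying the planarization: the vertices of `G` and the crossings, with the
crossing-free edges of `G` and an edge between each crossing and each of the four ends of the two
edges that make the crossing. -/
def planarization (X : CrossingSystem G) : SimpleGraph (V ⊕ X.Crossing) where
  Adj
    | .inl x, .inl y => G.Adj x y ∧ ∀ p ∈ X.pairs, s(x, y) ∉ p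
    | .inl x, .inr c => ∃ e ∈ c.1, x ∈ e
    | .inr c, .inl x => ∃ e ∈ c.1, x ∈ e
    | .inr _, .inr _ => False
  symm := ⟨by
    rintro (x | c) (y | c') h
    · exact ⟨h.1.symm, fun p hp hm => h.2 p hp (by rwa [Sym2.eq_swap])⟩
    · exact h
    · exact h
    · exact h⟩
  loopless := ⟨by
    rintro (x | c) h
    · exact G.loopless.irrefl x h.1
    · exact h⟩

/-- The instance is circular: for each crossing of edges `u₁u₃` and `u₂u₄`, there is a cycle
`(u₁, w₁, u₂, w₂, u₃, w₃, u₄, w₄)` of crossing-free edges of `G` where each `wᵢ` has degree `2`. -/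
def IsCircular (X : CrossingSystem G) : Prop :=
  ∀ u₁ u₂ u₃ u₄ : V, s(s(u₁, u₃), s(u₂, u₄)) ∈ X.pairs →
    ∃ w₁ w₂ w₃ w₄ : V,
      [u₁, w₁, u₂, w₂, u₃, w₃, u₄, w₄].Nodup ∧
      (∀ w ∈ [w₁, w₂, w₃, w₄], (G.neighborSet w).ncard = 2) ∧
      X.planarization.Adj (.inl u₁) (.inl w₁) ∧ X.planarization.Adj (.inl w₁) (.inl u₂) ∧
      X.planarization.Adj (.inl u₂) (.inl w₂) ∧ X.planarization.Adj (.inl w₂) (.inl u₃) ∧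
      X.planarization.Adj (.inl u₃) (.inl w₃) ∧ X.planarization.Adj (.inl w₃) (.inl u₄) ∧
      X.planarization.Adj (.inl u₄) (.inl w₄) ∧ X.planarization.Adj (.inl w₄) (.inl u₁)

/-- The edges of the planarization that make up the edge `e` of `G`. -/
def trace (X : CrossingSystem G) (e : Sym2 V) : Set (Sym2 (V ⊕ X.Crossing)) :=
  {b | (∃ x y : V, e = s(x, y) ∧ X.planarization.Adj (.inl x) (.inl y) ∧
          b = s(.inl x, .inl y)) ∨
       ∃ c : X.Crossing, e ∈ c.1 ∧ ∃ x ∈ e, b = s(.inl x, .inr c)}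

end CrossingSystem

/-- A 1-plane embedding of `G` with crossing system `X`: a plane embedding of the planarization
in which the ends of the two crossing edges alternate around each crossing. Thus
any two terms of this type are cross-preserving embeddings of each other. -/
structure OnePlaneEmbedding (X : CrossingSystem G) extends PlaneEmbedding X.planarization where
  alternating : ∀ (c : X.Crossing) (d : X.planarization.Dart), d.fst = .inr c →
    ∃ x y : V, d.snd = .inl x ∧ (rot (rot d)).snd = .inl y ∧ s(x, y) ∈ c.1

/-- A cycle `(u, c, v, s)` of the planarization with vertices `u, v` of `G` and crossings
`c, s`. -/
structure CrossingCycle (X : CrossingSystem G) where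
  u : V
  c : X.Crossing
  v : V
  s : X.Crossing
  u_ne_v : u ≠ v
  c_ne_s : c ≠ s
  adj_uc : X.planarization.Adj (.inl u) (.inr c)
  adj_cv : X.planarization.Adj (.inr c) (.inl v)
  adj_vs : X.planarization.Adj (.inl v) (.inr s)
  adj_su : X.planarization.Adj (.inr s) (.inl u)

/-- The edges of the cycle. -/
def CrossingCycle.edges {X : CrossingSystem G} (C : CrossingCycle X) :
    Set (Sym2 (V ⊕ X.Crossing)) :=
  {s(.inl C.u, .inr C.c), s(.inr C.c, .inl C.v), s(.inl C.v, .inr C.s), s(.inr C.s, .inl C.u)}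

namespace OnePlaneEmbedding

variable {X : CrossingSystem G} (γ : OnePlaneEmbedding X)

/-- The faces in the interior of `C`. -/
def interior (C : CrossingCycle X) : Set γ.Face := γ.intFaces C.edges

/-- The faces in the exterior of `C`. -/
def exterior (C : CrossingCycle X) : Set γ.Face := γ.extFaces C.edges

/-- The side `S` of `C = (u, c, v, s)` contains neither a crossing-free edge `uv` nor a crossing
adjacent to both `u` and `v`. -/
def IsClear (C : CrossingCycle X) (S : Set γ.Face) : Prop :=
  (¬ ∃ d : X.planarization.Dart, d.fst = .inl C.u ∧ d.snd = .inl C.v ∧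
      γ.left d ∈ S ∧ γ.left d.symm ∈ S) ∧
  ¬ ∃ c' : X.Crossing, X.planarization.Adj (.inl C.u) (.inr c') ∧
      X.planarization.Adj (.inl C.v) (.inr c') ∧ γ.VertexIn C.edges S (.inr c')

/-- The vertices in `V - {u, v}` on the side `S` of `C = (u, c, v, s)` adjacent to `c` or `s`. -/
def crossingNeighbors (C : CrossingCycle X) (S : Set γ.Face) : Set V :=
  {x | x ≠ C.u ∧ x ≠ C.v ∧
    (X.planarization.Adj (.inl x) (.inr C.c) ∨ X.planarization.Adj (.inl x) (.inr C.s)) ∧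
    γ.VertexIn C.edges S (.inl x)}

/-- No face on the side `S` of `C = (u, c, v, s)` has both `u` and `v` on its boundary. -/
def IsHardOn (C : CrossingCycle X) (S : Set γ.Face) : Prop :=
  ∀ f ∈ S, ¬ (γ.Incident (.inl C.u) f ∧ γ.Incident (.inl C.v) f)

/-- Candidate posi-cycles (of length 4). -/
def IsCandidatePosi (C : CrossingCycle X) : Prop := γ.IsClear C (γ.interior C)

/-- Candidate nega-cycles (of length 4). -/
def IsCandidateNega (C : CrossingCycle X) : Prop := γ.IsClear C (γ.exterior C)

/-- B-cycles (of length 4): exactly one vertex adjacent to `c` or `s` is in the exterior. -/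
def IsBCycle (C : CrossingCycle X) : Prop :=
  γ.IsCandidatePosi C ∧ ∃! x, x ∈ γ.crossingNeighbors C (γ.exterior C)

/-- W-cycles: no vertex adjacent to `c` or `s` is in the exterior. -/
def IsWCycle (C : CrossingCycle X) : Prop :=
  γ.IsCandidatePosi C ∧ γ.crossingNeighbors C (γ.exterior C) = ∅

/-- Posi-cycles: the hard B-cycles and the hard W-cycles. -/
def IsPosi (C : CrossingCycle X) : Prop :=
  (γ.IsBCycle C ∨ γ.IsWCycle C) ∧ γ.IsHardOn C (γ.interior C)

/-- Nega-cycles: the conditions for posi-cycles with interior and exterior exchanged. -/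
def IsNega (C : CrossingCycle X) : Prop :=
  γ.IsCandidateNega C ∧ (γ.crossingNeighbors C (γ.interior C)).Subsingleton ∧
    γ.IsHardOn C (γ.exterior C)

/-- There is a path of the planarization from `z` to `x` all of whose vertices other than `x` are
off the cycle `C` and on its side `S`. -/
def HasPath (C : CrossingCycle X) (S : Set γ.Face) (z x : V) : Prop :=
  ∃ P : X.planarization.Walk (.inl z) (.inl x), P.IsPath ∧
    ∀ w ∈ P.support, w ≠ .inl x → γ.VertexIn C.edges S w

/-- `z` is an in-factor of the posi- or nega-cycle `C = (u, c, v, s)`: the exterior of `C` (if `C`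
is a posi-cycle), or its interior (if `C` is a nega-cycle), has a path from `z` to `u` and a path
from `z` to `v`. -/
def IsInFactor (C : CrossingCycle X) (z : V) : Prop :=
  (γ.IsPosi C ∧ γ.HasPath C (γ.exterior C) z C.u ∧ γ.HasPath C (γ.exterior C) z C.v) ∨
  (γ.IsNega C ∧ γ.HasPath C (γ.interior C) z C.u ∧ γ.HasPath C (γ.interior C) z C.v)

/-- There is a path of the planarization from the vertex `x` of `C` to the vertex `x'` of `C'` that
meets `C` only in `x` and is otherwise in the exterior of `C`, and that meets `C'` only in `x'` and
is otherwise on the side `S'` of `C'`. -/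
def HasLink (C C' : CrossingCycle X) (S' : Set γ.Face) (x x' : V) : Prop :=
  ∃ P : X.planarization.Walk (.inl x) (.inl x'), P.IsPath ∧
    (∀ w ∈ P.support, w ≠ .inl x → γ.VertexIn C.edges (γ.exterior C) w) ∧
    ∀ w ∈ P.support, w ≠ .inl x' → γ.VertexIn C'.edges S' w

/-- Forbidden cycle pairs: a posi-cycle `C = (u, c, v, s)` and a posi- or nega-cycle
`C' = (u', c', v', s')`, linked by a path from `u` to `u'` and a path from `v` to `v'`. -/
def IsForbiddenPair (C C' : CrossingCycle X) : Prop :=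
  γ.IsPosi C ∧
  ((γ.IsPosi C' ∧ Disjoint (γ.interior C) (γ.interior C') ∧
      γ.HasLink C C' (γ.exterior C') C.u C'.u ∧ γ.HasLink C C' (γ.exterior C') C.v C'.v) ∨
   (γ.IsNega C' ∧ γ.interior C ⊆ γ.interior C' ∧
      γ.HasLink C C' (γ.interior C') C.u C'.u ∧ γ.HasLink C C' (γ.interior C') C.v C'.v))

/-- A B-configuration: edges `u₁u₂`, `u₂u₃`, `u₃u₄` such that `u₁u₂` and `u₃u₄` cross, at `c` say,
and the closed curve from `u₂` via `c` to `u₃` and back along the edge `u₂u₃` (which may have a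
crossing itself) has `u₁` and `u₄` in its interior. -/
def HasBConfiguration : Prop :=
  ∃ (u₁ u₂ u₃ u₄ : V) (c : X.Crossing),
    c.1 = s(s(u₁, u₂), s(u₃, u₄)) ∧ G.Adj u₂ u₃ ∧
    γ.VertexInt ({s(.inl u₂, .inr c), s(.inr c, .inl u₃)} ∪ X.trace s(u₂, u₃)) (.inl u₁) ∧
    γ.VertexInt ({s(.inl u₂, .inr c), s(.inr c, .inl u₃)} ∪ X.trace s(u₂, u₃)) (.inl u₄)

/-- A W-configuration: edges `u₁u₂`, `u₂u₃`, `v₁v₂`, `v₂v₃` such that `u₁u₂` and `v₂v₃` cross, at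
`c` say, `u₂u₃` and `v₁v₂` cross, at `s ≠ c` say, and the closed curve through `u₂, c, v₂, s` has
`u₁, u₃, v₁, v₃` in its interior. -/
def HasWConfiguration : Prop :=
  ∃ (u₁ u₂ u₃ v₁ v₂ v₃ : V) (c s : X.Crossing),
    c ≠ s ∧ c.1 = s(s(u₁, u₂), s(v₂, v₃)) ∧ s.1 = s(s(u₂, u₃), s(v₁, v₂)) ∧
    ∀ x ∈ [u₁, u₃, v₁, v₃], γ.VertexInt
      {s(.inl u₂, .inr c), s(.inr c, .inl v₂), s(.inl v₂, .inr s), s(.inr s, .inl u₂)} (.inl x)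

/-- The point set of the drawing of the planarization in which the vertices have the positions
`pos` and the edges are straight-line segments. -/
def pointSet (X : CrossingSystem G) (pos : V ⊕ X.Crossing → ℂ) : Set ℂ :=
  Set.range pos ∪ ⋃ d : X.planarization.Dart, segment ℝ (pos d.fst) (pos d.snd)

/-- A straight-line drawing of `G` in the plane `ℂ` that induces the 1-plane embedding `γ`. -/
structure StraightLineDrawing where
  /-- the positions of the vertices and of the crossings -/
  pos : V ⊕ X.Crossing → ℂ
  pos_injective : Function.Injective pos
  /-- an edge of `G` with a crossing is a segment as well, with the crossing in its inside -/
  straight : ∀ (c : X.Crossing) (x y : V), s(x, y) ∈ c.1 →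
    pos (.inr c) ∈ openSegment ℝ (pos (.inl x)) (pos (.inl y))
  vertex_mem : ∀ (w : V ⊕ X.Crossing) (d : X.planarization.Dart),
    pos w ∈ segment ℝ (pos d.fst) (pos d.snd) → w = d.fst ∨ w = d.snd
  /-- different edges of the planarization meet in common ends only -/
  edge_inter : ∀ d d' : X.planarization.Dart, d.edge ≠ d'.edge →
    ∀ z ∈ segment ℝ (pos d.fst) (pos d.snd), z ∈ segment ℝ (pos d'.fst) (pos d'.snd) →
      ∃ w, w ∈ d.edge ∧ w ∈ d'.edge ∧ pos w = z
  /-- `rot d` comes first after `d` counterclockwise; angles are taken in `(0, 2π]` -/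
  rot_ccw : ∀ d d' : X.planarization.Dart, d.fst = d'.fst →
    toIocMod Real.two_pi_pos 0 (Complex.arg
        ((pos (γ.rot d).snd - pos (γ.rot d).fst) / (pos d.snd - pos d.fst))) ≤
      toIocMod Real.two_pi_pos 0 (Complex.arg
        ((pos d'.snd - pos d'.fst) / (pos d.snd - pos d.fst)))
  /-- the faces are the connected components of the complement of the drawing -/
  region : γ.Face → Set ℂ
  region_injective : Function.Injective region
  region_component : ∀ f, ∃ z ∉ pointSet X pos,
    region f = connectedComponentIn (pointSet X pos)ᶜ z
  region_surjective : ∀ z ∉ pointSet X pos, ∃ f, z ∈ region f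
  /-- points close to the midpoint of `d`, on its left, are in the face on the left of `d` -/
  region_left : ∀ d : X.planarization.Dart, ∀ᶠ ε : ℝ in nhdsWithin 0 (Set.Ioi 0),
    (pos d.fst + pos d.snd) / 2 + (ε : ℂ) * (Complex.I * (pos d.snd - pos d.fst)) ∈
      region (γ.left d)
  region_isolated : ∀ (w : V ⊕ X.Crossing) (h : ∀ w', ¬ X.planarization.Adj w w'),
    pos w ∈ closure (region (γ.isoFace w h))
  outer_unbounded : ¬ Bornology.IsBounded (region γ.outer)

/-- The 1-plane embedding is straight-line drawable. -/
def IsSLD : Prop := Nonempty γ.StraightLineDrawing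

end OnePlaneEmbedding

end OnePlane

/-! The proof rests on an invariant that does not depend on the embedding. Let `C = (u, c, v, s)`.
If one side of `C` has no face at both `u` and `v`, then `c` and `s` are connected on that side by a
walk avoiding `C` (`exists_attached_of_hard`). Conversely, such a connection separates `u` from `v`
on its side (`not_linked_of_attached`). The connection is a piece of the graph, so another
cross-preserving embedding can only move it to the other side of `C`. There `C` satisfies all the
conditions for that side (`IsGood.transfer`): posi if the connection is in the interior, nega if it
is in the exterior. It is never both, since circularity yields a face at both `u` and `v`.

For (i), an in-factor is attached to `u` and `v` and lies opposite to the connection. Separation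
keeps it opposite in every embedding, so its side determines the kind of `C`.

For (ii), suppose that neither cycle of the pair is a posi-cycle in `γ'`. Then both connections are
in the exteriors. The links attach each vertex of one cycle that is off the other to both ends `u`,
`v` of the other, so it cannot be in the exterior of that other cycle. Hence the exteriors agree,
and so do the edge sets of the cycles. In `γ` both sides of this one cycle would then be free of
faces at both `u` and `v`, against circularity.

In a posi-cycle, the neighbours off the cycle at a crossing not on an edge `uv` are in the interior,
which gives a B- or W-configuration. In a straight-line drawing this forces each of `c`, `s` into
the triangle spanned by the other one and `u`, `v`. Then both are on the segment `uv`, which is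
impossible.

All the topology is homology mod 2 of the rotation system. Euler's formula enters once, in
`exists_potential`: every even edge set bounds a set of faces. -/

namespace OnePlane

universe u

/-! ### Chains of edges mod 2 -/

namespace PlaneEmbedding

variable {W : Type u} {H : SimpleGraph W}

/-- The sum of a function on darts over the darts with tail `w`, modulo `2`. -/
def boundary [Fintype H.Dart] [DecidableEq W] (g : H.Dart → ZMod 2) (w : W) : ZMod 2 :=
  ∑ d with d.fst = w, g d

/-- The characteristic function of an edge. -/
def edgeChain [DecidableEq W] (a b : W) (d : H.Dart) : ZMod 2 := if d.edge = s(a, b) then 1 else 0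

theorem edgeChain_symm [DecidableEq W] (a b : W) (d : H.Dart) : edgeChain a b d.symm = edgeChain a b d := by
  simp [edgeChain]

section Boundary

variable [Fintype H.Dart]

theorem boundary_add [DecidableEq W] (g g' : H.Dart → ZMod 2) (w : W) :
    boundary (fun d => g d + g' d) w = boundary g w + boundary g' w :=
  Finset.sum_add_distrib

/-- The handshake lemma: a symmetric function supported on darts with both or no ends in `M` has
even total degree on `M`. -/
theorem sum_eq_zero_of_closed (g : H.Dart → ZMod 2) (hg : ∀ d, g d.symm = g d) (M : W → Prop)
    [DecidablePred M] (hM : ∀ d, g d ≠ 0 → M d.fst → M d.snd) :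
    ∑ d with M d.fst, g d = 0 := by
  have h2 : ∑ d with M d.fst ∧ g d ≠ 0, g d = 0 := by
    refine Finset.sum_involution (fun d _ => d.symm) ?_ ?_ ?_ ?_
    · intro d _
      rw [hg]
      exact CharTwo.add_self_eq_zero _
    · intro d _ _
      exact d.symm_ne
    · intro d hd
      simp only [Finset.mem_filter, Finset.mem_univ, true_and] at hd ⊢
      exact ⟨hM d hd.2 hd.1, by rw [hg]; exact hd.2⟩
    · intro d _
      exact d.symm_symm
  rw [← h2]
  refine (Finset.sum_subset ?_ ?_).symm
  · intro d hd
    simp only [Finset.mem_filter, Finset.mem_univ, true_and] at hd ⊢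
    exact hd.1
  · intro d hd hd'
    simp only [Finset.mem_filter, Finset.mem_univ, true_and, not_and, not_not] at hd hd'
    exact hd' hd

theorem sum_eq_sum_boundary [DecidableEq W] [Fintype W] (g : H.Dart → ZMod 2) (M : W → Prop) [DecidablePred M] :
    ∑ d with M d.fst, g d = ∑ w with M w, boundary g w := by
  unfold boundary
  rw [Finset.sum_comm' (s := Finset.univ.filter M) (t := fun w => {d | d.fst = w})
    (t' := Finset.univ.filter fun d : H.Dart => M d.fst) (s' := fun d => {d.fst})]
  · simp
  · intro x y
    simp only [Finset.mem_filter, Finset.mem_univ, true_and, Finset.mem_singleton]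
    constructor
    · rintro ⟨h, rfl⟩
      exact ⟨rfl, h⟩
    · rintro ⟨rfl, h⟩
      exact ⟨h, rfl⟩

theorem boundary_edgeChain [DecidableEq W] {a b : W} (h : H.Adj a b) (w : W) :
    boundary (H := H) (edgeChain a b) w = (if w = a then 1 else 0) + (if w = b then 1 else 0) := by
  have hab : a ≠ b := h.ne
  unfold boundary edgeChain
  rw [Finset.sum_ite, Finset.sum_const_zero, add_zero, Finset.sum_const, nsmul_one]
  have key : ∀ (a b : W) (h : H.Adj a b),
      ((Finset.univ.filter fun d : H.Dart => d.fst = a).filter fun d => d.edge = s(a, b)) =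
        {⟨(a, b), h⟩} := by
    intro a b h
    ext d
    simp only [Finset.mem_filter, Finset.mem_univ, true_and, Finset.mem_singleton,
      SimpleGraph.dart_edge_eq_mk'_iff']
    constructor
    · rintro ⟨h1, h2 | h2⟩
      · exact SimpleGraph.Dart.ext _ _ (Prod.ext h2.1 h2.2)
      · exact absurd (h1.symm.trans h2.1) h.ne
    · rintro rfl
      simp
  by_cases hwa : w = a
  · subst hwa
    rw [key w b h]
    simp [hab]
  · by_cases hwb : w = b
    · subst hwb
      rw [show s(a, w) = s(w, a) from Sym2.eq_swap, key w a h.symm]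
      simp [hwa]
    · rw [Finset.filter_eq_empty_iff.2]
      · simp [hwa, hwb]
      · intro d hd he
        rw [Finset.mem_filter] at hd
        rw [SimpleGraph.dart_edge_eq_mk'_iff'] at he
        rcases he with he | he
        · exact hwa (hd.2.symm.trans he.1)
        · exact hwb (hd.2.symm.trans he.1)

/-- A walk with all its edges in `R` carries a chain whose boundary consists of its ends. -/
theorem exists_chain [DecidableEq W] (R : W → W → Prop) (hR : ∀ a b, R a b → H.Adj a b) {x y : W}
    (h : Relation.ReflTransGen R x y) :
    ∃ q : H.Dart → ZMod 2, (∀ d, q d.symm = q d) ∧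
      (∀ d, q d ≠ 0 → R d.fst d.snd ∨ R d.snd d.fst) ∧
      ∀ w, boundary q w = (if w = x then 1 else 0) + (if w = y then 1 else 0) := by
  induction h with
  | refl =>
    refine ⟨fun _ => 0, fun _ => rfl, fun d hd => absurd rfl hd, fun w => ?_⟩
    rw [CharTwo.add_self_eq_zero]
    exact Finset.sum_const_zero
  | @tail b c _ hbc ih =>
    obtain ⟨q, h1, h2, h3⟩ := ih
    refine ⟨fun d => q d + edgeChain b c d, fun d => ?_, fun d hd => ?_, fun w => ?_⟩
    · simp only [h1, edgeChain_symm]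
    · by_cases hq : q d = 0
      · simp only [hq, zero_add] at hd
        unfold edgeChain at hd
        have he : d.edge = s(b, c) := by
          by_contra hne
          exact hd (if_neg hne)
        rcases SimpleGraph.dart_edge_eq_mk'_iff'.1 he with ⟨ha, hb⟩ | ⟨ha, hb⟩
        · exact .inl (ha ▸ hb ▸ hbc)
        · exact .inr (ha ▸ hb ▸ hbc)
      · exact h2 d hq
    · rw [boundary_add, h3, boundary_edgeChain (hR _ _ hbc)]
      calc _ = (if w = x then 1 else 0) + ((if w = b then 1 else 0) + (if w = b then 1 else 0))
            + (if w = c then (1 : ZMod 2) else 0) := by ring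
        _ = _ := by rw [CharTwo.add_self_eq_zero, add_zero]

end Boundary

/-! ### Functions on the faces, and exactness from Euler's formula -/

variable (E : PlaneEmbedding H)

theorem incident_left_fst (d : H.Dart) : E.Incident d.fst (E.left d) := .inl ⟨d, rfl, rfl⟩

theorem incident_left_snd (d : H.Dart) : E.Incident d.snd (E.left d) := by
  refine .inl ⟨E.rot.symm d.symm, ?_, ?_⟩
  · have := E.rot_fst (E.rot.symm d.symm)
    rw [Equiv.apply_symm_apply] at this
    exact this.symm
  · have := E.left_rot (E.rot.symm d.symm)
    rwa [Equiv.apply_symm_apply, SimpleGraph.Dart.symm_symm, eq_comm] at this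

theorem incident_left_symm_fst (d : H.Dart) : E.Incident d.fst (E.left d.symm) :=
  E.incident_left_snd d.symm

theorem incident_left_symm_snd (d : H.Dart) : E.Incident d.snd (E.left d.symm) :=
  E.incident_left_fst d.symm

theorem exists_incident (w : W) : ∃ f, E.Incident w f := by
  by_cases h : ∀ w', ¬ H.Adj w w'
  · exact ⟨_, .inr ⟨h, rfl⟩⟩
  · push Not at h
    obtain ⟨w', h⟩ := h
    exact ⟨_, E.incident_left_fst ⟨(w, w'), h⟩⟩

theorem incident_iff_of_adj {w w' : W} (h : H.Adj w w') (f : E.Face) :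
    E.Incident w f ↔ ∃ d : H.Dart, d.fst = w ∧ E.left d = f := by
  refine ⟨fun hf => hf.resolve_right ?_, .inl⟩
  rintro ⟨h', -⟩
  exact h' _ h

/-- A function on the faces that does not change across the edges at `w` is constant around `w`. -/
theorem eq_of_incident {α : Type*} (h : E.Face → α) (w : W)
    (hw : ∀ d : H.Dart, d.fst = w → h (E.left d) = h (E.left d.symm)) [Finite H.Dart]
    {f f' : E.Face} (hf : E.Incident w f) (hf' : E.Incident w f') : h f = h f' := by
  by_cases hiso : ∀ w', ¬ H.Adj w w'
  · have aux : ∀ g, E.Incident w g → E.isoFace w hiso = g := by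
      rintro g (⟨d, rfl, -⟩ | ⟨_, hg⟩)
      · exact absurd d.adj (hiso _)
      · exact hg
    rw [← aux f hf, aux f' hf']
  · push Not at hiso
    obtain ⟨w', hww'⟩ := hiso
    rw [E.incident_iff_of_adj hww'] at hf hf'
    obtain ⟨d, hd, rfl⟩ := hf
    obtain ⟨d', hd', rfl⟩ := hf'
    -- The sector between `e` and `rot e` belongs to one face, so a turn by one dart crosses only
    -- the edge of `rot e`.
    have step : ∀ e : H.Dart, e.fst = w → h (E.left (E.rot e)) = h (E.left e) := by
      intro e he
      rw [hw (E.rot e) ((E.rot_fst e).trans he), E.left_rot]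
    have iter : ∀ n : ℕ, ((E.rot ^ n) d).fst = w ∧ h (E.left ((E.rot ^ n) d)) = h (E.left d) := by
      intro n
      induction n with
      | zero => exact ⟨hd, rfl⟩
      | succ n ih =>
        rw [pow_succ', Equiv.Perm.mul_apply]
        exact ⟨(E.rot_fst _).trans ih.1, (step _ ih.1).trans ih.2⟩
    obtain ⟨n, hn⟩ := (E.rot_cyclic d d' (hd.trans hd'.symm)).exists_nat_pow_eq
    rw [← hn, (iter n).2]

/-- The change of a function on the faces across an edge, modulo `2`. -/
def coboundary (h : E.Face → ZMod 2) (d : H.Dart) : ZMod 2 := h (E.left d) + h (E.left d.symm)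

theorem coboundary_symm (h : E.Face → ZMod 2) (d : H.Dart) :
    E.coboundary h d.symm = E.coboundary h d := by
  rw [coboundary, coboundary, d.symm_symm, add_comm]

theorem left_eq_of_coboundary {h : E.Face → ZMod 2} {d : H.Dart} (hd : E.coboundary h d = 0) :
    h (E.left d) = h (E.left d.symm) := CharTwo.add_eq_zero.1 hd

theorem coboundary_eq_zero {h : E.Face → ZMod 2} {d : H.Dart}
    (hd : h (E.left d) = h (E.left d.symm)) : E.coboundary h d = 0 := CharTwo.add_eq_zero.2 hd

/-- Each sector at `w` is counted twice: it is on the left of a dart `d` and on the right of `rot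
d`. -/
theorem boundary_coboundary [Fintype H.Dart] [DecidableEq W] (h : E.Face → ZMod 2) (w : W) :
    boundary (E.coboundary h) w = 0 := by
  unfold boundary coboundary
  rw [Finset.sum_add_distrib]
  have : ∑ d : H.Dart with d.fst = w, h (E.left d.symm) =
      ∑ d : H.Dart with d.fst = w, h (E.left d) := by
    refine (Finset.sum_bij (fun d _ => E.rot d) ?_ ?_ ?_ ?_).symm
    · intro d hd
      simp only [Finset.mem_filter, Finset.mem_univ, true_and] at hd ⊢
      exact (E.rot_fst d).trans hd
    · intro d _ d' _ hdd
      exact E.rot.injective hdd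
    · intro d hd
      simp only [Finset.mem_filter, Finset.mem_univ, true_and] at hd
      refine ⟨E.rot.symm d, ?_, by simp⟩
      have := E.rot_fst (E.rot.symm d)
      rw [Equiv.apply_symm_apply] at this
      simp [← this, hd]
    · intro d _
      rw [E.left_rot]
  rw [this, CharTwo.add_self_eq_zero]

theorem eq_of_coboundary_eq_zero {h : E.Face → ZMod 2} (hh : ∀ d, E.coboundary h d = 0)
    (f g : E.Face) : h f = h g := by
  induction E.dual_connected f g with
  | refl => rfl
  | tail _ hs ih =>
    obtain ⟨d, rfl, rfl⟩ := hs
    rw [ih, E.left_eq_of_coboundary (hh d)]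

theorem finite_face [Finite H.Dart] : Finite E.Face := by
  refine Set.finite_univ_iff.1 (((Set.finite_singleton E.outer).union
    (Set.finite_range E.left)).subset ?_)
  intro f _
  rcases Relation.ReflTransGen.cases_tail (E.dual_connected E.outer f) with h | ⟨_, _, d, _, h⟩
  · exact .inl h
  · exact .inr ⟨_, h⟩

/-- In a plane embedding, every even set of edges is the set of edges between a set of faces and
its complement. -/
theorem exists_potential [Finite W] [Fintype H.Dart] [DecidableEq W] (g : H.Dart → ZMod 2)
    (hg : ∀ d, g d.symm = g d) (hb : ∀ w, boundary g w = 0) :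
    ∃ h : E.Face → ZMod 2, ∀ d, E.coboundary h d = g d := by
  classical
  have := Fintype.ofFinite W
  have := E.finite_face
  have := Fintype.ofFinite E.Face
  have := Fintype.ofFinite H.edgeSet
  have := Fintype.ofFinite H.ConnectedComponent
  have hdart : ∀ e : H.edgeSet, ∃ d : H.Dart, d.edge = e := by
    rintro ⟨e, he⟩
    induction e with
    | _ a b => exact ⟨⟨(a, b), he⟩, rfl⟩
  -- An orientation of every edge, to pass between symmetric functions on darts and functions on
  -- edges.
  choose D hD using hdart
  have hDd : ∀ d : H.Dart, D ⟨d.edge, d.edge_mem⟩ = d ∨ D ⟨d.edge, d.edge_mem⟩ = d.symm :=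
    fun d => (SimpleGraph.dart_edge_eq_iff _ _).1 (hD ⟨d.edge, d.edge_mem⟩)
  have hval : ∀ k : H.Dart → ZMod 2, (∀ d, k d.symm = k d) →
      ∀ d : H.Dart, k (D ⟨d.edge, d.edge_mem⟩) = k d := by
    intro k hk d
    rcases hDd d with h | h
    · rw [h]
    · rw [h, hk]
  -- The incidence matrix is the boundary map. With the coboundary map `L`, exactness is `range L =
  -- ker M`, proved by comparing dimensions.
  let M : Matrix W H.edgeSet (ZMod 2) := Matrix.of fun w e => if w ∈ e.1 then 1 else 0
  have hM : ∀ k : H.Dart → ZMod 2, (∀ d, k d.symm = k d) → ∀ w,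
      M.mulVec (fun e => k (D e)) w = boundary k w := by
    intro k hk w
    simp only [Matrix.mulVec, dotProduct, M, Matrix.of_apply, ite_mul, one_mul, zero_mul, boundary]
    rw [← Finset.sum_filter]
    symm
    refine Finset.sum_bij (fun d _ => ⟨d.edge, d.edge_mem⟩) ?_ ?_ ?_ ?_
    · intro d hd
      simp only [Finset.mem_filter, Finset.mem_univ, true_and] at hd ⊢
      rw [← hd]
      exact Sym2.mem_mk_left _ _
    · intro d hd d' hd' h
      simp only [Finset.mem_filter, Finset.mem_univ, true_and] at hd hd'
      rcases (SimpleGraph.dart_edge_eq_iff _ _).1 (Subtype.ext_iff.1 h) with h | h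
      · exact h
      · exfalso
        subst h
        exact d'.snd_ne_fst (hd.trans hd'.symm)
    · rintro ⟨e, he⟩ hw
      simp only [Finset.mem_filter, Finset.mem_univ, true_and] at hw
      obtain ⟨b, rfl⟩ := hw
      exact ⟨⟨(w, b), he⟩, by simp, rfl⟩
    · intro d _
      rw [hval k hk]
  let L : (E.Face → ZMod 2) →ₗ[ZMod 2] (H.edgeSet → ZMod 2) :=
    { toFun := fun h e => E.coboundary h (D e)
      map_add' := fun h h' => by
        funext e
        simp only [coboundary, Pi.add_apply]
        ring
      map_smul' := fun c h => by
        funext e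
        simp only [coboundary, Pi.smul_apply, smul_eq_mul, RingHom.id_apply]
        ring }
  have hL : ∀ h e, L h e = E.coboundary h (D e) := fun _ _ => rfl
  have hle : LinearMap.range L ≤ LinearMap.ker M.mulVecLin := by
    rintro _ ⟨h, rfl⟩
    rw [LinearMap.mem_ker, Matrix.mulVecLin_apply]
    funext w
    rw [show L h = fun e => E.coboundary h (D e) from rfl, hM _ (E.coboundary_symm h),
      E.boundary_coboundary]
    rfl
  -- The kernel of `L` consists of constants, because the faces are connected across edges.
  have hker : Module.finrank (ZMod 2) (LinearMap.ker L) ≤ 1 := by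
    refine finrank_le_one ⟨fun _ => 1, ?_⟩ ?_
    · rw [LinearMap.mem_ker]
      funext e
      exact CharTwo.add_self_eq_zero _
    · rintro ⟨h, hh⟩
      refine ⟨h E.outer, Subtype.ext (funext fun f => ?_)⟩
      have h0 : ∀ d, E.coboundary h d = 0 := by
        intro d
        rw [← hval _ (E.coboundary_symm h), ← hL, LinearMap.mem_ker.1 hh]
        rfl
      simpa using E.eq_of_coboundary_eq_zero h0 E.outer f
  -- A function in the kernel of the transpose is constant on each component, so it is determined by
  -- one value per component.
  have hT : Module.finrank (ZMod 2) (LinearMap.ker M.transpose.mulVecLin) ≤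
      Fintype.card H.ConnectedComponent := by
    let R : LinearMap.ker M.transpose.mulVecLin →ₗ[ZMod 2] (H.ConnectedComponent → ZMod 2) :=
      (LinearMap.funLeft (ZMod 2) (ZMod 2) fun c : H.ConnectedComponent => c.out).comp
        (Submodule.subtype _)
    have hR : Function.Injective R := by
      rw [← LinearMap.ker_eq_bot, LinearMap.ker_eq_bot']
      rintro ⟨k, hk⟩ hk0
      refine Subtype.ext (funext fun w => ?_)
      have hadj : ∀ a b, H.Adj a b → k a = k b := by
        intro a b hab
        have := congrFun (LinearMap.mem_ker.1 hk) ⟨s(a, b), hab⟩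
        rw [Matrix.mulVecLin_apply] at this
        simp only [Matrix.mulVec, dotProduct, M, Matrix.transpose_apply, Matrix.of_apply, ite_mul, one_mul, zero_mul,
          Pi.zero_apply, Sym2.mem_iff] at this
        rw [← Finset.sum_filter, show (Finset.univ.filter fun x => x = a ∨ x = b) = {a, b} by
          ext x; simp, Finset.sum_pair hab.ne] at this
        exact CharTwo.add_eq_zero.1 this
      have hreach : ∀ a b, H.Reachable a b → k a = k b := by
        rintro a b ⟨p⟩
        induction p with
        | nil => rfl
        | cons h _ ih => exact (hadj _ _ h).trans ih
      have h1 := congrFun hk0 (H.connectedComponentMk w)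
      have h2 : H.Reachable (H.connectedComponentMk w).out w :=
        SimpleGraph.ConnectedComponent.exact (Quot.out_eq _)
      exact (hreach _ _ h2).symm.trans h1
    have := LinearMap.finrank_le_finrank_of_injective hR
    rwa [Module.finrank_fintype_fun_eq_card] at this
  have r1 := LinearMap.finrank_range_add_finrank_ker L
  have r2 := LinearMap.finrank_range_add_finrank_ker M.mulVecLin
  have r3 := LinearMap.finrank_range_add_finrank_ker M.transpose.mulVecLin
  have r4 : Module.finrank (ZMod 2) (LinearMap.range M.transpose.mulVecLin) =
      Module.finrank (ZMod 2) (LinearMap.range M.mulVecLin) := Matrix.rank_transpose M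
  rw [Module.finrank_fintype_fun_eq_card] at r1 r2 r3
  have he := E.euler
  rw [Nat.card_eq_fintype_card, Nat.card_eq_fintype_card, Nat.card_eq_fintype_card,
    Nat.card_eq_fintype_card] at he
  -- The rank of `L` is at least `|F| - 1`, and `ker M` has dimension at most `|E| - |V|` plus the
  -- number of components. Euler's formula equates the two bounds.
  have hrange := Submodule.eq_of_le_of_finrank_le hle (by omega)
  have hmem : (fun e => g (D e)) ∈ LinearMap.range L := by
    rw [hrange, LinearMap.mem_ker, Matrix.mulVecLin_apply]
    funext w
    rw [hM g hg, hb]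
    rfl
  obtain ⟨h, hh⟩ := hmem
  refine ⟨h, fun d => ?_⟩
  rw [← hval _ (E.coboundary_symm h), ← hval g hg]
  exact congrFun hh _

end PlaneEmbedding

theorem PlaneEmbedding.boundary_eq_add {W : Type u} {H : SimpleGraph W} [Fintype H.Dart]
    [DecidableEq W] (g : H.Dart → ZMod 2) {w a b : W} (hab : a ≠ b) (ha : H.Adj w a)
    (hb : H.Adj w b) (h : ∀ d : H.Dart, d.fst = w → d.snd ≠ a → d.snd ≠ b → g d = 0) :
    boundary g w = g ⟨(w, a), ha⟩ + g ⟨(w, b), hb⟩ := by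
  unfold boundary
  refine Finset.sum_eq_add _ _ ?_ ?_ ?_ ?_
  · intro he
    exact hab (congrArg (fun d : H.Dart => d.snd) he)
  · rintro d hd ⟨h1, h2⟩
    rw [Finset.mem_filter] at hd
    refine h d hd.2 (fun h3 => h1 ?_) fun h3 => h2 ?_
    · exact SimpleGraph.Dart.ext _ _ (Prod.ext hd.2 h3)
    · exact SimpleGraph.Dart.ext _ _ (Prod.ext hd.2 h3)
  · simp
  · simp

instance {W : Type u} {H : SimpleGraph W} [Finite W] : Finite H.Dart :=
  Finite.of_injective _ SimpleGraph.Dart.toProd_injective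

variable {V : Type u} {G : SimpleGraph V} {X : CrossingSystem G}

/-! ### Walks that avoid a crossing cycle -/

namespace CrossingCycle

variable (C : CrossingCycle X)

/-- The vertex `w` is not on the cycle. -/
def Off (w : V ⊕ X.Crossing) : Prop := ∀ e ∈ C.edges, w ∉ e

theorem off_iff (w : V ⊕ X.Crossing) :
    C.Off w ↔ w ≠ .inl C.u ∧ w ≠ .inl C.v ∧ w ≠ .inr C.c ∧ w ≠ .inr C.s := by
  simp only [Off, edges, Set.mem_insert_iff, Set.mem_singleton_iff, forall_eq_or_imp, forall_eq,
    Sym2.mem_iff, not_or]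
  tauto

theorem off_inl (x : V) : C.Off (.inl x) ↔ x ≠ C.u ∧ x ≠ C.v := by
  rw [off_iff]
  simp

theorem off_inr (x : X.Crossing) : C.Off (.inr x) ↔ x ≠ C.c ∧ x ≠ C.s := by
  rw [off_iff]
  simp

/-- The vertices are joined by a walk that avoids the cycle. -/
def Joined (a b : V ⊕ X.Crossing) : Prop :=
  Relation.ReflTransGen (fun x y => X.planarization.Adj x y ∧ C.Off x ∧ C.Off y) a b

theorem Joined.refl (a : V ⊕ X.Crossing) : C.Joined a a := Relation.ReflTransGen.refl

variable {C}

theorem Joined.symm {a b : V ⊕ X.Crossing} (h : C.Joined a b) : C.Joined b a := by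
  induction h with
  | refl => exact Joined.refl C _
  | tail _ h ih => exact Relation.ReflTransGen.head ⟨h.1.symm, h.2.2, h.2.1⟩ ih

theorem Joined.trans {a b c : V ⊕ X.Crossing} (h : C.Joined a b) (h' : C.Joined b c) :
    C.Joined a c := Relation.ReflTransGen.trans h h'

theorem Joined.off {a b : V ⊕ X.Crossing} (h : C.Joined a b) (ha : C.Off a) : C.Off b := by
  induction h with
  | refl => exact ha
  | tail _ h _ => exact h.2.2

theorem Joined.of_adj {a b : V ⊕ X.Crossing} (ha : C.Off a) (hb : C.Off b)
    (h : X.planarization.Adj a b) : C.Joined a b := Relation.ReflTransGen.single ⟨h, ha, hb⟩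

variable (C)

/-- The vertex `a` is not on the cycle, and is joined to `x` by a walk that otherwise avoids the
cycle. -/
def Attached (a x : V ⊕ X.Crossing) : Prop :=
  C.Off a ∧ ∃ b, C.Joined a b ∧ X.planarization.Adj b x

variable {C}

theorem Attached.of_adj {a x : V ⊕ X.Crossing} (ha : C.Off a) (h : X.planarization.Adj a x) :
    C.Attached a x := ⟨ha, a, Joined.refl C a, h⟩

theorem Attached.of_joined {a b x : V ⊕ X.Crossing} (h : C.Joined a b) (ha : C.Off a)
    (hb : C.Attached b x) : C.Attached a x := by
  obtain ⟨_, c, hc, hx⟩ := hb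
  exact ⟨ha, c, h.trans hc, hx⟩

theorem Attached.of_walk {a x : V ⊕ X.Crossing} (p : X.planarization.Walk a x)
    (hp : ∀ w ∈ p.support, w ≠ x → C.Off w) (hax : a ≠ x) : C.Attached a x := by
  induction p with
  | nil => exact absurd rfl hax
  | @cons a b x h p ih =>
    have ha : C.Off a := hp a (by simp) hax
    by_cases hbx : b = x
    · exact Attached.of_adj ha (hbx ▸ h)
    · have hb : C.Off b := hp b (by simp) hbx
      exact Attached.of_joined (Joined.of_adj ha hb h) ha
        (ih (fun w hw => hp w (by simp [hw])) hbx)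

variable (C)

theorem not_mem_edges_of_off {d : X.planarization.Dart} (h : C.Off d.fst) : d.edge ∉ C.edges :=
  fun he => h _ he (Sym2.mem_mk_left _ _)

theorem not_mem_edges_of_off_snd {d : X.planarization.Dart} (h : C.Off d.snd) :
    d.edge ∉ C.edges :=
  fun he => h _ he (Sym2.mem_mk_right _ _)

theorem edge_mem_iff (d : X.planarization.Dart) :
    d.edge ∈ C.edges ↔
      ((d.fst = .inl C.u ∨ d.fst = .inl C.v) ∧ (d.snd = .inr C.c ∨ d.snd = .inr C.s)) ∨
      ((d.snd = .inl C.u ∨ d.snd = .inl C.v) ∧ (d.fst = .inr C.c ∨ d.fst = .inr C.s)) := by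
  simp only [edges, Set.mem_insert_iff, Set.mem_singleton_iff,
    SimpleGraph.dart_edge_eq_mk'_iff']
  tauto

/-- The cycle traversed from `u` to `v` via `s` first. -/
def swap : CrossingCycle X where
  u := C.u
  c := C.s
  v := C.v
  s := C.c
  u_ne_v := C.u_ne_v
  c_ne_s := C.c_ne_s.symm
  adj_uc := C.adj_su.symm
  adj_cv := C.adj_vs.symm
  adj_vs := C.adj_cv.symm
  adj_su := C.adj_uc.symm

theorem swap_edges : C.swap.edges = C.edges := by
  ext e
  simp only [edges, swap, Set.mem_insert_iff, Set.mem_singleton_iff]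
  rw [show s(Sum.inl C.u, Sum.inr C.s) = s(Sum.inr C.s, Sum.inl C.u) from Sym2.eq_swap,
    show s(Sum.inr C.s, Sum.inl C.v) = s(Sum.inl C.v, Sum.inr C.s) from Sym2.eq_swap,
    show s(Sum.inl C.v, Sum.inr C.c) = s(Sum.inr C.c, Sum.inl C.v) from Sym2.eq_swap,
    show s(Sum.inr C.c, Sum.inl C.u) = s(Sum.inl C.u, Sum.inr C.c) from Sym2.eq_swap]
  tauto

end CrossingCycle

/-! ### The two sides of a cycle, and separation of `u` from `v` -/

namespace OnePlaneEmbedding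

variable (γ : OnePlaneEmbedding X) (C : CrossingCycle X)

open PlaneEmbedding

/-- The side of the cycle on which the face `f` lies: `0` for the exterior, `1` for the interior. -/
noncomputable def side (f : γ.Face) : ZMod 2 :=
  open Classical in if f ∈ γ.exterior C then 0 else 1

theorem side_eq_zero {f : γ.Face} : γ.side C f = 0 ↔ f ∈ γ.exterior C := by
  unfold side
  split_ifs with h <;> simp [h]

theorem side_eq_one {f : γ.Face} : γ.side C f = 1 ↔ f ∈ γ.interior C := by
  rw [show f ∈ γ.interior C ↔ f ∉ γ.exterior C from Iff.rfl]
  unfold side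
  split_ifs with h <;> simp [h]

theorem side_outer : γ.side C γ.outer = 0 :=
  (γ.side_eq_zero C).2 Relation.ReflTransGen.refl

theorem side_left_eq {d : X.planarization.Dart} (hd : d.edge ∉ C.edges) :
    γ.side C (γ.left d) = γ.side C (γ.left d.symm) := by
  have h : γ.left d ∈ γ.exterior C ↔ γ.left d.symm ∈ γ.exterior C :=
    ⟨fun h => h.tail ⟨d, hd, rfl, rfl⟩, fun h => h.tail ⟨d.symm, by simpa using hd, rfl, by simp⟩⟩
  by_cases hl : γ.left d ∈ γ.exterior C
  · rw [(γ.side_eq_zero C).2 hl, (γ.side_eq_zero C).2 (h.1 hl)]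
  · rw [(γ.side_eq_one C).2 hl, (γ.side_eq_one C).2 (fun h' => hl (h.2 h'))]

-- The four edges are distinct, and each of the four vertices is on two of them. Hence the cycle is
-- an even set to which `exists_potential` applies.
open Classical in
theorem cycle_chain [Finite V] [Fintype X.planarization.Dart] :
    (∀ d : X.planarization.Dart, (if d.symm.edge ∈ C.edges then 1 else 0 : ZMod 2) =
      if d.edge ∈ C.edges then 1 else 0) ∧
    ∀ w, boundary (fun d : X.planarization.Dart =>
      if d.edge ∈ C.edges then (1 : ZMod 2) else 0) w = 0 := by
  have huv := C.u_ne_v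
  have hcs := C.c_ne_s
  have key : (fun d : X.planarization.Dart => if d.edge ∈ C.edges then (1 : ZMod 2) else 0) =
      fun d => (edgeChain (.inl C.u) (.inr C.c) d + edgeChain (.inr C.c) (.inl C.v) d) +
        (edgeChain (.inl C.v) (.inr C.s) d + edgeChain (.inr C.s) (.inl C.u) d) := by
    funext d
    simp only [edgeChain, CrossingCycle.edges, Set.mem_insert_iff, Set.mem_singleton_iff]
    by_cases h1 : d.edge = s(.inl C.u, .inr C.c)
    · simp [h1, huv, hcs]
    by_cases h2 : d.edge = s(.inr C.c, .inl C.v)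
    · simp [h2, huv.symm, hcs]
    by_cases h3 : d.edge = s(.inl C.v, .inr C.s)
    · simp [h3, huv.symm, hcs.symm]
    by_cases h4 : d.edge = s(.inr C.s, .inl C.u)
    · simp [h4, huv, hcs.symm]
    simp [h1, h2, h3, h4]
  refine ⟨fun d => by rw [d.edge_symm], fun w => ?_⟩
  rw [key, boundary_add, boundary_add, boundary_add, boundary_edgeChain C.adj_uc,
    boundary_edgeChain C.adj_cv, boundary_edgeChain C.adj_vs, boundary_edgeChain C.adj_su]
  have h2 : (2 : ZMod 2) = 0 := rfl
  linear_combination ((if w = .inl C.u then 1 else 0) + (if w = .inr C.c then 1 else 0) +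
    (if w = .inl C.v then 1 else 0) + (if w = .inr C.s then 1 else 0)) * h2

/-- The Jordan curve theorem for the cycle: exactly one of the two faces at an edge of the cycle
is in the exterior. -/
theorem coboundary_side [Finite V] {d : X.planarization.Dart} (hd : d.edge ∈ C.edges) :
    γ.coboundary (γ.side C) d = 1 := by
  classical
  have := Fintype.ofFinite X.planarization.Dart
  have huv : (Sum.inl C.u : V ⊕ X.Crossing) ≠ .inl C.v := fun h => C.u_ne_v (Sum.inl_injective h)
  have hcs : (Sum.inr C.c : V ⊕ X.Crossing) ≠ .inr C.s := fun h => C.c_ne_s (Sum.inr_injective h)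
  have off : ∀ d : X.planarization.Dart, d.edge ∉ C.edges → γ.coboundary (γ.side C) d = 0 :=
    fun d hd => γ.coboundary_eq_zero (γ.side_left_eq C hd)
  -- At a vertex of the cycle only its two cycle edges can change the side, and the changes sum to
  -- zero. So the change is the same on all four edges.
  have atc := boundary_eq_add (γ.coboundary (γ.side C)) huv C.adj_uc.symm C.adj_cv
    fun d h1 h2 h3 => off d (by rw [C.edge_mem_iff]; simp [h1, h2, h3])
  have ats := boundary_eq_add (γ.coboundary (γ.side C)) huv C.adj_su C.adj_vs.symm
    fun d h1 h2 h3 => off d (by rw [C.edge_mem_iff]; simp [h1, h2, h3])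
  have atu := boundary_eq_add (γ.coboundary (γ.side C)) hcs C.adj_uc C.adj_su.symm
    fun d h1 h2 h3 => off d (by rw [C.edge_mem_iff]; simp [h1, h2, h3])
  rw [boundary_coboundary, eq_comm, CharTwo.add_eq_zero] at atc ats atu
  have sw : ∀ (a b : V ⊕ X.Crossing) (h : X.planarization.Adj a b),
      γ.coboundary (γ.side C) ⟨(a, b), h⟩ = γ.coboundary (γ.side C) ⟨(b, a), h.symm⟩ :=
    fun a b h => (γ.coboundary_symm _ _).symm
  have all : ∀ d : X.planarization.Dart, d.edge ∈ C.edges →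
      γ.coboundary (γ.side C) d = γ.coboundary (γ.side C) ⟨(_, _), C.adj_uc⟩ := by
    have e1 := sw _ _ C.adj_uc
    have e2 := sw _ _ C.adj_cv
    have e3 := sw _ _ C.adj_vs
    have e4 := sw _ _ C.adj_su
    rintro ⟨⟨a, b⟩, hab⟩ hd
    rw [C.edge_mem_iff] at hd
    dsimp only at hd
    rcases hd with ⟨rfl | rfl, rfl | rfl⟩ | ⟨rfl | rfl, rfl | rfl⟩
    · rfl
    · exact atu.symm
    · exact e2.symm.trans (atc.symm.trans e1.symm)
    · exact e3.trans (ats.symm.trans (e4.trans atu.symm))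
    · exact e1.symm
    · exact e4.trans atu.symm
    · exact atc.symm.trans e1.symm
    · exact ats.symm.trans (e4.trans atu.symm)
  rw [all d hd]
  by_contra hne
  have h0 : γ.coboundary (γ.side C) ⟨(_, _), C.adj_uc⟩ = 0 := by
    generalize γ.coboundary (γ.side C) ⟨(_, _), C.adj_uc⟩ = x at hne
    revert x
    decide
  have h1 : ∀ d, γ.coboundary (γ.side C) d = 0 := by
    intro d
    by_cases hd : d.edge ∈ C.edges
    · rw [all d hd, h0]
    · exact off d hd
  -- If no edge changes the side, every face is reached from the outer face without crossing the
  -- cycle. A potential of the cycle is then constant, though it must jump on cycle edges.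
  have hext : ∀ f, f ∈ γ.exterior C := fun f => (γ.side_eq_zero C).1
    ((γ.eq_of_coboundary_eq_zero h1 f γ.outer).trans (γ.side_outer C))
  obtain ⟨h, hh⟩ := γ.exists_potential _ (cycle_chain C).1 (cycle_chain C).2
  have hconst : ∀ f, h f = h γ.outer := by
    intro f
    induction hext f with
    | refl => rfl
    | tail _ hs ih =>
      obtain ⟨d, hd, rfl, rfl⟩ := hs
      rw [← ih]
      exact (γ.left_eq_of_coboundary (by rw [hh, if_neg hd])).symm
  have := hh ⟨(_, _), C.adj_uc⟩
  rw [γ.coboundary_eq_zero ((hconst _).trans (hconst _).symm), if_pos] at this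
  · exact absurd this (by decide)
  · exact (C.edge_mem_iff _).2 (by simp)

/-- All faces at `w` are on the side `t` of the cycle. -/
def OnSide (t : ZMod 2) (w : V ⊕ X.Crossing) : Prop := ∀ f, γ.Incident w f → γ.side C f = t

variable {γ C}

theorem OnSide.unique {t t' : ZMod 2} {w : V ⊕ X.Crossing} (h : γ.OnSide C t w)
    (h' : γ.OnSide C t' w) : t = t' := by
  obtain ⟨f, hf⟩ := γ.exists_incident w
  rw [← h f hf, ← h' f hf]

theorem onSide_of_incident [Finite V] {t : ZMod 2} {w : V ⊕ X.Crossing} (hw : C.Off w)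
    {f : γ.Face} (hf : γ.Incident w f) (ht : γ.side C f = t) : γ.OnSide C t w := by
  intro f' hf'
  rw [← ht]
  refine γ.eq_of_incident _ w (fun d hd => γ.side_left_eq C ?_) hf' hf
  exact C.not_mem_edges_of_off (hd ▸ hw)

theorem exists_onSide [Finite V] {w : V ⊕ X.Crossing} (hw : C.Off w) :
    ∃ t, γ.OnSide C t w := by
  obtain ⟨f, hf⟩ := γ.exists_incident w
  exact ⟨_, onSide_of_incident hw hf rfl⟩

theorem OnSide.of_adj [Finite V] {t : ZMod 2} {w w' : V ⊕ X.Crossing} (h : γ.OnSide C t w)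
    (hw' : C.Off w') (ha : X.planarization.Adj w w') : γ.OnSide C t w' :=
  onSide_of_incident hw' (γ.incident_left_snd ⟨(w, w'), ha⟩)
    (h _ (γ.incident_left_fst ⟨(w, w'), ha⟩))

theorem OnSide.of_joined [Finite V] {t : ZMod 2} {w w' : V ⊕ X.Crossing} (h : γ.OnSide C t w)
    (hj : C.Joined w w') : γ.OnSide C t w' := by
  induction hj with
  | refl => exact h
  | tail _ ha ih => exact ih.of_adj ha.2.2 ha.1

variable (γ C)

/-- The face `f` is at `x`, or at a vertex that is joined to `x` without meeting the cycle and the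
component of `a`. -/
def Linked (a : V ⊕ X.Crossing) (f : γ.Face) (x : V ⊕ X.Crossing) : Prop :=
  γ.Incident x f ∨ ∃ z, γ.Incident z f ∧ ¬ C.Joined a z ∧ C.Attached z x

variable {γ C}

/-- The walk from `z` to `x` stays outside the component of `a`, so `k` is constant around each of
its vertices, and consecutive vertices share a face. -/
theorem Linked.eq [Finite V] {a x : V ⊕ X.Crossing} {f f' : γ.Face} (h : γ.Linked C a f x)
    (k : γ.Face → ZMod 2)
    (hk : ∀ d : X.planarization.Dart, C.Off d.fst → ¬ C.Joined a d.fst → γ.coboundary k d = 0)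
    (hx : ∀ d : X.planarization.Dart, d.fst = x → γ.coboundary k d = 0) (hf' : γ.Incident x f') :
    k f = k f' := by
  have atx : ∀ {g g'}, γ.Incident x g → γ.Incident x g' → k g = k g' := fun hg hg' =>
    γ.eq_of_incident k x (fun d hd => γ.left_eq_of_coboundary (hx d hd)) hg hg'
  rcases h with h | ⟨z, hz, hna, hoff, b, hzb, hbx⟩
  · exact atx h hf'
  · have atz : ∀ {w g g'}, C.Off w → ¬ C.Joined a w → γ.Incident w g → γ.Incident w g' →
        k g = k g' := fun ho hn hg hg' => γ.eq_of_incident k _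
      (fun d hd => γ.left_eq_of_coboundary (hk d (hd ▸ ho) (hd ▸ hn))) hg hg'
    have main : ∀ g, γ.Incident b g → k f = k g := by
      clear hbx
      induction hzb with
      | refl => exact fun g hg => atz hoff hna hz hg
      | @tail b c hb hc ih =>
        intro g hg
        have hzc : C.Joined z c := CrossingCycle.Joined.trans hb (.of_adj hc.2.1 hc.2.2 hc.1)
        rw [ih _ (γ.incident_left_fst ⟨(b, c), hc.1⟩)]
        exact atz hc.2.2 (fun hac => hna (hac.trans hzc.symm))
          (γ.incident_left_snd ⟨(b, c), hc.1⟩) hg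
    rw [main _ (γ.incident_left_fst ⟨(b, x), hbx⟩)]
    exact atx (γ.incident_left_snd ⟨(b, x), hbx⟩) hf'

variable (γ C)

/-- A connection between `c` and `s` on one side of the cycle separates `u` from `v` on that
side. -/
theorem not_linked_of_attached [Finite V] {t : ZMod 2} {a : V ⊕ X.Crossing}
    (hac : C.Attached a (.inr C.c)) (has : C.Attached a (.inr C.s)) (ha : γ.OnSide C t a)
    {f : γ.Face} (hf : γ.side C f = t) (hu : γ.Linked C a f (.inl C.u))
    (hv : γ.Linked C a f (.inl C.v)) : False := by
  classical
  have := Fintype.ofFinite X.planarization.Dart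
  have huv := C.u_ne_v
  have hcs := C.c_ne_s
  -- Edges that may occur in a walk from `c` to `s` through the component of `a`. The resulting
  -- chain `q` has no edge at `u`, at `v`, or at an off-cycle vertex outside that component.
  let R : V ⊕ X.Crossing → V ⊕ X.Crossing → Prop := fun x y => X.planarization.Adj x y ∧
    ((C.Joined a x ∧ (C.Joined a y ∨ y = .inr C.c ∨ y = .inr C.s)) ∨
      (C.Joined a y ∧ (x = .inr C.c ∨ x = .inr C.s)))
  have hwalk : Relation.ReflTransGen R (.inr C.c) (.inr C.s) := by
    obtain ⟨hoff, b, hab, hbc⟩ := hac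
    obtain ⟨-, b', hab', hbs⟩ := has
    have hbb : Relation.ReflTransGen R b b' := by
      have aux : ∀ y, C.Joined b y → Relation.ReflTransGen R b y := by
        intro y hy
        induction hy with
        | refl => exact .refl
        | tail hx hxy ih =>
          exact ih.tail ⟨hxy.1, .inl ⟨hab.trans hx, .inl (hab.trans (.tail hx hxy))⟩⟩
      exact aux _ (hab.symm.trans hab')
    exact (Relation.ReflTransGen.head ⟨hbc.symm, .inr ⟨hab, .inl rfl⟩⟩ hbb).tail
      ⟨hbs, .inl ⟨hab', .inr (.inr rfl)⟩⟩
  obtain ⟨q, hq1, hq2, hq3⟩ := exists_chain R (fun _ _ h => h.1) hwalk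
  have hoffa : C.Off a := hac.1
  have nju : ¬ C.Joined a (.inl C.u) := fun h => ((C.off_iff _).1 (h.off hoffa)).1 rfl
  have njv : ¬ C.Joined a (.inl C.v) := fun h => ((C.off_iff _).1 (h.off hoffa)).2.1 rfl
  have njc : ¬ C.Joined a (.inr C.c) := fun h => ((C.off_iff _).1 (h.off hoffa)).2.2.1 rfl
  have hqfst : ∀ d, q d ≠ 0 → C.Joined a d.fst ∨ d.fst = .inr C.c ∨ d.fst = .inr C.s := by
    intro d hd
    rcases hq2 d hd with h | h <;> rcases h.2 with h | h <;> tauto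
  have hqc : ∀ d, q d ≠ 0 → d.fst = .inr C.c → C.Joined a d.snd := by
    intro d hd hc
    have h1 : ¬ C.Joined a d.fst := hc ▸ njc
    rcases hq2 d hd with h | h
    · exact (h.2.resolve_left fun h => h1 h.1).1
    · exact (h.2.resolve_right fun h => h1 h.1).1
  -- The cycle `C` and the chain `q` form a theta. This is a potential of its closed chain through
  -- `u`.
  obtain ⟨h₀, hh₀⟩ := γ.exists_potential
    (fun d => q d + (edgeChain (.inl C.u) (.inr C.c) d + edgeChain (.inr C.s) (.inl C.u) d))
    (fun d => by simp only [hq1, edgeChain_symm])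
    (fun w => by
      rw [boundary_add, boundary_add, hq3, boundary_edgeChain C.adj_uc,
        boundary_edgeChain C.adj_su]
      have h2 : (2 : ZMod 2) = 0 := rfl
      linear_combination ((if w = .inl C.u then 1 else 0) + (if w = .inr C.c then 1 else 0) +
        (if w = .inr C.s then 1 else 0)) * h2)
  obtain ⟨fv, hfv⟩ := γ.exists_incident (.inl C.v)
  -- Normalized to vanish around `v`, where the closed chain has no edge.
  let h₁ : γ.Face → ZMod 2 := fun f => h₀ f + h₀ fv
  have hh₁ : ∀ d, γ.coboundary h₁ d =
      q d + (edgeChain (.inl C.u) (.inr C.c) d + edgeChain (.inr C.s) (.inl C.u) d) := by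
    intro d
    rw [← hh₀]
    have h2 : (2 : ZMod 2) = 0 := rfl
    simp only [coboundary, h₁]
    linear_combination h₀ fv * h2
  have edge0 : ∀ (x y : V ⊕ X.Crossing) (d : X.planarization.Dart), d.fst ≠ x → d.fst ≠ y →
      edgeChain x y d = 0 := by
    intro x y d h1 h2
    unfold edgeChain
    rw [if_neg]
    rw [SimpleGraph.dart_edge_eq_mk'_iff']
    tauto
  have hoff₁ : ∀ d : X.planarization.Dart, C.Off d.fst → ¬ C.Joined a d.fst →
      γ.coboundary h₁ d = 0 := by
    intro d hd hn
    have hd' := (C.off_iff _).1 hd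
    rw [hh₁, edge0 _ _ _ hd'.1 hd'.2.2.1, edge0 _ _ _ hd'.2.2.2 hd'.1]
    by_contra hne
    have := hqfst d (by simpa using hne)
    tauto
  have hv₁ : ∀ d : X.planarization.Dart, d.fst = .inl C.v → γ.coboundary h₁ d = 0 := by
    intro d hd
    rw [hh₁, edge0 _ _ _ (by simp [hd, huv.symm]) (by simp [hd]), edge0 _ _ _ (by simp [hd])
      (by simp [hd, huv.symm])]
    by_contra hne
    have := hqfst d (by simpa using hne)
    simp [hd, njv] at this
  -- Adding the cycle exchanges the path `c, u, s` for `c, v, s`, so this potential does not change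
  -- around `u`.
  let h₂ : γ.Face → ZMod 2 := fun f => h₁ f + γ.side C f
  have hh₂ : ∀ d, γ.coboundary h₂ d = γ.coboundary h₁ d + γ.coboundary (γ.side C) d := by
    intro d
    simp only [coboundary, h₂]
    ring
  have hoff₂ : ∀ d : X.planarization.Dart, C.Off d.fst → ¬ C.Joined a d.fst →
      γ.coboundary h₂ d = 0 := by
    intro d hd hn
    rw [hh₂, hoff₁ d hd hn, γ.coboundary_eq_zero (γ.side_left_eq C (C.not_mem_edges_of_off hd)),
      add_zero]
  have hu₂ : ∀ d : X.planarization.Dart, d.fst = .inl C.u → γ.coboundary h₂ d = 0 := by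
    intro d hd
    have hqd : q d = 0 := by
      by_contra hne
      have := hqfst d hne
      simp [hd, nju] at this
    rw [hh₂, hh₁, hqd, zero_add]
    by_cases hC : d.edge ∈ C.edges
    · rw [γ.coboundary_side C hC]
      rw [C.edge_mem_iff] at hC
      unfold edgeChain
      simp only [hd, Sum.inl.injEq, huv, reduceCtorEq, or_false, and_false, true_and] at hC
      rcases hC with hC | hC <;>
      · simp [SimpleGraph.dart_edge_eq_mk'_iff', hd, hC, hcs, hcs.symm]
        decide
    · rw [γ.coboundary_eq_zero (γ.side_left_eq C hC)]
      rw [C.edge_mem_iff] at hC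
      unfold edgeChain
      simp only [hd, Sum.inl.injEq, huv, reduceCtorEq, or_false, and_false, true_and] at hC
      simp [SimpleGraph.dart_edge_eq_mk'_iff', hd, not_or.1 hC]
  have hzero : ∀ g, γ.Incident (.inl C.v) g → h₁ g = 0 := by
    intro g hg
    rw [Linked.eq (a := a) (.inl hg) h₁ hoff₁ hv₁ hfv]
    exact CharTwo.add_self_eq_zero _
  -- Since `f` is linked to `v`, `h₁ f = 0` and thus `h₂ f = t`. Since `f` is linked to `u`, the
  -- value `t` of `h₂` carries over to the faces at `u`.
  have hside : ∀ g, γ.Incident (.inl C.u) g → h₁ g = γ.side C g + t := by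
    intro g hg
    have e1 : h₁ f = 0 := (hv.eq h₁ hoff₁ hv₁ hfv).trans (hzero _ hfv)
    have e2 := hu.eq h₂ hoff₂ hu₂ hg
    simp only [h₂, e1, hf, zero_add] at e2
    rw [e2]
    have h2 : (2 : ZMod 2) = 0 := rfl
    linear_combination (- γ.side C g) * h2
  -- The factor cuts `h₁` off on side `t`, which hides the jumps along `q`. Around `c`, the cut-off
  -- function then jumps at the edge to `u` only, but the number of jumps around a vertex is even.
  let k : γ.Face → ZMod 2 := fun g => (γ.side C g + t) * h₁ g
  have idem : ∀ x : ZMod 2, x * x = x := by decide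
  have hsum := boundary_eq_add (γ.coboundary k) (w := .inr C.c) (a := .inl C.u) (b := .inl C.v)
    (by simpa using huv) C.adj_uc.symm C.adj_cv ?_
  · rw [boundary_coboundary] at hsum
    have e1 : γ.coboundary k ⟨(.inr C.c, .inl C.u), C.adj_uc.symm⟩ = 1 := by
      have l1 := hside _ (γ.incident_left_snd ⟨(.inr C.c, .inl C.u), C.adj_uc.symm⟩)
      have l2 := hside _ (γ.incident_left_symm_snd ⟨(.inr C.c, .inl C.u), C.adj_uc.symm⟩)
      simp only [coboundary, k]
      rw [l1, l2, idem, idem, ← γ.coboundary_side C (d := ⟨(.inr C.c, .inl C.u), C.adj_uc.symm⟩)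
        ((C.edge_mem_iff _).2 (by simp))]
      have h2 : (2 : ZMod 2) = 0 := rfl
      simp only [coboundary]
      linear_combination t * h2
    have e2 : γ.coboundary k ⟨(.inr C.c, .inl C.v), C.adj_cv⟩ = 0 := by
      have l1 := hzero _ (γ.incident_left_snd ⟨(.inr C.c, .inl C.v), C.adj_cv⟩)
      have l2 := hzero _ (γ.incident_left_symm_snd ⟨(.inr C.c, .inl C.v), C.adj_cv⟩)
      simp only [coboundary, k]
      rw [l1, l2, mul_zero, mul_zero, add_zero]
    rw [e1, e2] at hsum
    exact absurd hsum (by decide)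
  · intro d hd h1 h2
    have hC : d.edge ∉ C.edges := by
      rw [C.edge_mem_iff]
      simp [hd, h1, h2]
    apply γ.coboundary_eq_zero
    simp only [k]
    rw [← γ.side_left_eq C hC]
    -- An edge at `c` off the cycle either is not in `q`, and `h₁` does not jump there, or leads
    -- into the component of `a`, and both its faces are on side `t`.
    by_cases hq : q d = 0
    · have := hh₁ d
      rw [hq, zero_add] at this
      have hz : γ.coboundary h₁ d = 0 := by
        rw [this]
        unfold edgeChain
        simp [SimpleGraph.dart_edge_eq_mk'_iff', hd, h1]
      rw [γ.left_eq_of_coboundary hz]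
    · rw [(ha.of_joined (hqc d hq hd)) _ (γ.incident_left_snd d), CharTwo.add_self_eq_zero,
        zero_mul, zero_mul]

/-- If no face on the side `t` of the cycle is at both `u` and `v`, then `c` and `s` are connected
on that side. -/
theorem exists_attached_of_hard [Finite V] {t : ZMod 2}
    (hard : ∀ f, γ.side C f = t → γ.Incident (.inl C.u) f → ¬ γ.Incident (.inl C.v) f) :
    ∃ a, C.Attached a (.inr C.c) ∧ C.Attached a (.inr C.s) ∧ γ.OnSide C t a := by
  classical
  by_contra hnone
  push Not at hnone
  have := Fintype.ofFinite V
  have := Fintype.ofFinite X.Crossing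
  have := Fintype.ofFinite X.planarization.Dart
  have huv := C.u_ne_v
  -- The fan of the faces at `u` on side `t`. Part `g` of its boundary is off the cycle and would
  -- lead from `c` to `s`.
  let z : γ.Face → ZMod 2 := fun f => if γ.side C f = t ∧ γ.Incident (.inl C.u) f then 1 else 0
  let g : X.planarization.Dart → ZMod 2 :=
    fun d => if d.edge ∈ C.edges then 0 else γ.coboundary z d
  let g' : X.planarization.Dart → ZMod 2 :=
    fun d => if d.edge ∈ C.edges then γ.coboundary z d else 0
  have hgg' : (fun d => g d + g' d) = γ.coboundary z := by
    funext d
    simp only [g, g']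
    split_ifs <;> simp
  -- The part of `g` that can be reached from `c`. It cannot end at `u`, where the fan does not
  -- change off the cycle, nor at `v` by hardness, nor at `s`, since that would be a connection on
  -- side `t`.
  let M : V ⊕ X.Crossing → Prop := fun w => w = .inr C.c ∨ C.Attached w (.inr C.c)
  have zv : ∀ f, γ.Incident (.inl C.v) f → z f = 0 := by
    intro f hf
    exact if_neg fun h => hard f h.1 h.2 hf
  have closed : ∀ d, g d ≠ 0 → M d.fst → M d.snd := by
    intro d hd hM
    have hC : d.edge ∉ C.edges := fun h => hd (if_pos h)
    have hd' : γ.coboundary z d ≠ 0 := by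
      simpa only [g, if_neg hC] using hd
    by_cases hu : d.snd = .inl C.u
    · exfalso
      refine hd' (γ.coboundary_eq_zero ?_)
      have l1 : γ.Incident (.inl C.u) (γ.left d) := hu ▸ γ.incident_left_snd d
      have l2 : γ.Incident (.inl C.u) (γ.left d.symm) := hu ▸ γ.incident_left_symm_snd d
      simp only [z, l1, l2, γ.side_left_eq C hC]
    by_cases hv : d.snd = .inl C.v
    · exfalso
      refine hd' (γ.coboundary_eq_zero ?_)
      rw [zv _ (hv ▸ γ.incident_left_snd d), zv _ (hv ▸ γ.incident_left_symm_snd d)]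
    by_cases hc : d.snd = .inr C.c
    · exact .inl hc
    by_cases hs : d.snd = .inr C.s
    · exfalso
      rcases hM with hM | hM
      · have := d.adj
        rw [hM, hs] at this
        exact this
      · refine hnone _ hM (.of_adj hM.1 (hs ▸ d.adj)) ?_
        have : z (γ.left d) ≠ 0 ∨ z (γ.left d.symm) ≠ 0 := by
          by_contra hcon
          push Not at hcon
          exact hd' (γ.coboundary_eq_zero (hcon.1.trans hcon.2.symm))
        rcases this with h | h
        · have h' : γ.side C (γ.left d) = t := by
            by_contra hne
            exact h (if_neg fun h => hne h.1)
          exact onSide_of_incident hM.1 (γ.incident_left_fst d) h'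
        · have h' : γ.side C (γ.left d.symm) = t := by
            by_contra hne
            exact h (if_neg fun h => hne h.1)
          exact onSide_of_incident hM.1 (γ.incident_left_symm_fst d) h'
    have hoff : C.Off d.snd := (C.off_iff _).2 ⟨hu, hv, hc, hs⟩
    rcases hM with hM | hM
    · exact .inr (.of_adj hoff (hM ▸ d.adj.symm))
    · exact .inr (.of_joined (.of_adj hoff hM.1 d.adj.symm) hoff hM)
  have hsum := sum_eq_zero_of_closed g
    (fun d => by simp only [g, SimpleGraph.Dart.edge_symm, γ.coboundary_symm]) M closed
  replace hsum := (sum_eq_sum_boundary g M).symm.trans hsum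
  -- The other vertices of `M` are off the cycle, where `g` is the whole coboundary of `z` and has
  -- even degree. So `g` is even at `c` too, and hence `g'` is; but of the two cycle edges at `c`
  -- only the one to `u` is in `g'`.
  rw [Finset.sum_eq_single (.inr C.c)] at hsum
  · have h1 := boundary_add g g' (.inr C.c)
    rw [hgg', boundary_coboundary, hsum, zero_add,
      boundary_eq_add g' (a := .inl C.u) (b := .inl C.v) (by simpa using huv) C.adj_uc.symm
        C.adj_cv] at h1
    · have m1 : (⟨(.inr C.c, .inl C.u), C.adj_uc.symm⟩ : X.planarization.Dart).edge ∈ C.edges :=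
        (C.edge_mem_iff _).2 (by simp)
      have m2 : (⟨(.inr C.c, .inl C.v), C.adj_cv⟩ : X.planarization.Dart).edge ∈ C.edges :=
        (C.edge_mem_iff _).2 (by simp)
      simp only [g', if_pos m1, if_pos m2] at h1
      rw [γ.coboundary_eq_zero (d := ⟨(.inr C.c, .inl C.v), C.adj_cv⟩), add_zero] at h1
      · have l1 := γ.incident_left_snd ⟨(.inr C.c, .inl C.u), C.adj_uc.symm⟩
        have l2 := γ.incident_left_symm_snd ⟨(.inr C.c, .inl C.u), C.adj_uc.symm⟩
        have l3 := γ.coboundary_side C m1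
        dsimp only at l1 l2
        simp only [coboundary, z, l1, l2, and_true] at h1 l3
        generalize γ.side C (γ.left ⟨(.inr C.c, .inl C.u), C.adj_uc.symm⟩) = x at h1 l3
        generalize γ.side C (γ.left (SimpleGraph.Dart.symm
          ⟨(.inr C.c, .inl C.u), C.adj_uc.symm⟩)) = y at h1 l3
        clear * - h1 l3
        revert x y t
        decide
      · rw [zv _ (γ.incident_left_snd ⟨(.inr C.c, .inl C.v), C.adj_cv⟩),
          zv _ (γ.incident_left_symm_snd ⟨(.inr C.c, .inl C.v), C.adj_cv⟩)]
    · intro d hd h1 h2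
      refine if_neg ?_
      rw [C.edge_mem_iff]
      simp [hd, h1, h2]
  · intro w hw hne
    have hoff : C.Off w := ((Finset.mem_filter.1 hw).2.resolve_left hne).1
    rw [← γ.boundary_coboundary z w]
    refine Finset.sum_congr rfl fun d hd => if_neg ?_
    exact C.not_mem_edges_of_off ((Finset.mem_filter.1 hd).2 ▸ hoff)
  · intro h
    exact absurd (Finset.mem_filter.2 ⟨Finset.mem_univ _, .inl rfl⟩) h

end OnePlaneEmbedding

/-! ### The two edges of a crossing -/

namespace CrossingSystem

theorem adj_crossing_iff {x : V} {q : X.Crossing} :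
    X.planarization.Adj (.inl x) (.inr q) ↔ ∃ e ∈ q.1, x ∈ e := Iff.rfl

/-- Two different ends `u, v` of the edges of a crossing either are the ends of one of them, or
belong to different ones. -/
theorem crossing_cases {q : X.Crossing} {u v : V} (huv : u ≠ v)
    (hu : X.planarization.Adj (.inl u) (.inr q)) (hv : X.planarization.Adj (.inl v) (.inr q)) :
    s(u, v) ∈ q.1 ∨ ∃ x y, q.1 = s(s(u, x), s(v, y)) := by
  obtain ⟨q, hq⟩ := q
  obtain ⟨e, he, hue⟩ := hu
  obtain ⟨e', he', hve⟩ := hv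
  dsimp only at he he' ⊢
  by_cases hee : e = e'
  · subst hee
    exact .inl ((Sym2.mem_and_mem_iff huv).1 ⟨hue, hve⟩ ▸ he)
  · right
    obtain ⟨x, rfl⟩ := hue
    obtain ⟨y, rfl⟩ := hve
    exact ⟨x, y, (Sym2.mem_and_mem_iff hee).1 ⟨he, he'⟩⟩

section Crossing

variable {q : X.Crossing} {u v x y : V}

theorem mem_of_eq (hq : q.1 = s(s(u, x), s(v, y))) (e : Sym2 V) :
    e ∈ q.1 ↔ e = s(u, x) ∨ e = s(v, y) := by
  rw [hq, Sym2.mem_iff]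

theorem adj_iff_of_eq (hq : q.1 = s(s(u, x), s(v, y))) (z : V) :
    X.planarization.Adj (.inl z) (.inr q) ↔ (z = u ∨ z = x) ∨ z = v ∨ z = y := by
  rw [adj_crossing_iff]
  simp only [mem_of_eq hq, exists_eq_or_imp, exists_eq_left, Sym2.mem_iff]

theorem ne_of_eq (hq : q.1 = s(s(u, x), s(v, y))) :
    u ≠ x ∧ v ≠ y ∧ u ≠ v ∧ u ≠ y ∧ x ≠ v ∧ x ≠ y := by
  have h1 : G.Adj u x := X.edge_mem q.1 q.2 _ ((mem_of_eq hq _).2 (.inl rfl))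
  have h2 : G.Adj v y := X.edge_mem q.1 q.2 _ ((mem_of_eq hq _).2 (.inr rfl))
  have hm : s(s(u, x), s(v, y)) ∈ X.pairs := hq ▸ q.2
  have h3 := X.disjoint _ _ hm u (Sym2.mem_mk_left _ _)
  have h4 := X.disjoint _ _ hm x (Sym2.mem_mk_right _ _)
  rw [Sym2.mem_iff, not_or] at h3 h4
  exact ⟨h1.ne, h2.ne, h3.1, h3.2, h4.1, h4.2⟩

theorem eq_of_mem_of_eq (hq : q.1 = s(s(u, x), s(v, y))) {z : V} (hz : s(u, z) ∈ q.1) :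
    z = x := by
  have hne := ne_of_eq hq
  rw [mem_of_eq hq, Sym2.eq_iff, Sym2.eq_iff] at hz
  rcases hz with (⟨-, h⟩ | ⟨h, -⟩) | (⟨h, -⟩ | ⟨h, -⟩)
  · exact h
  · exact absurd h hne.1
  · exact absurd h hne.2.2.1
  · exact absurd h hne.2.2.2.1

end Crossing

theorem eq_of_mem_of_mem {q q' : X.Crossing} {e : Sym2 V} (h : e ∈ q.1) (h' : e ∈ q'.1) :
    q = q' := Subtype.ext (X.unique _ q.2 _ q'.2 e h h')

end CrossingSystem

/-! ### Posi- and nega-cycles in all cross-preserving embeddings -/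

namespace OnePlaneEmbedding

variable {γ : OnePlaneEmbedding X} {C : CrossingCycle X}

open PlaneEmbedding CrossingSystem

/-- Ends of the two edges of a crossing are consecutive around it. -/
theorem exists_common_face {q : X.Crossing} {u v x y : V} (hq : q.1 = s(s(u, x), s(v, y))) :
    ∃ f, γ.Incident (.inl x) f ∧ γ.Incident (.inl y) f := by
  have hne := ne_of_eq hq
  have adjq : X.planarization.Adj (.inr q) (.inl u) := ((adj_iff_of_eq hq u).2 (by simp)).symm
  let d : X.planarization.Dart := ⟨(.inr q, .inl u), adjq⟩
  have opp : ∀ (e : X.planarization.Dart), e.fst = .inr q → ∀ z, e.snd = .inl z →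
      ∃ z', (γ.rot (γ.rot e)).snd = .inl z' ∧ s(z, z') ∈ q.1 := by
    intro e he z hz
    obtain ⟨a, b, h1, h2, h3⟩ := γ.alternating q e he
    obtain rfl : z = a := Sum.inl_injective (hz.symm.trans h1)
    exact ⟨b, h2, h3⟩
  have hd1 : (γ.rot d).fst = .inr q := γ.rot_fst d
  have hd2 : (γ.rot (γ.rot d)).fst = .inr q := (γ.rot_fst _).trans hd1
  -- By alternation the second dart after the one to `u` leads to `x`. The dart in between leads to
  -- `v` or `y`; in the first case `y` comes right after `x`, in the second right before it.
  obtain ⟨x', hx', hx⟩ := opp d rfl u rfl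
  rw [eq_of_mem_of_eq hq hx] at hx'
  obtain ⟨z, -, hz, -⟩ := γ.alternating q (γ.rot d) hd1
  have hzadj : X.planarization.Adj (.inl z) (.inr q) := by
    have := (γ.rot d).adj
    rw [hz, hd1] at this
    exact this.symm
  rcases (adj_iff_of_eq hq z).1 hzadj with (rfl | rfl) | rfl | rfl
  · exfalso
    have : γ.rot d = d := SimpleGraph.Dart.ext _ _ (Prod.ext hd1 hz)
    rw [this, this] at hx'
    exact hne.1 (Sum.inl_injective hx')
  · exfalso
    have : γ.rot (γ.rot d) = γ.rot d :=
      SimpleGraph.Dart.ext _ _ (Prod.ext (hd2.trans hd1.symm) (hx'.trans hz.symm))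
    rw [γ.rot.injective this, γ.rot.injective this] at hx'
    exact hne.1 (Sum.inl_injective hx')
  · obtain ⟨y', hy', hy⟩ := opp _ hd1 z hz
    rw [eq_of_mem_of_eq (hq.trans Sym2.eq_swap) hy] at hy'
    have h1 := γ.incident_left_snd (γ.rot (γ.rot d))
    have h2 := γ.incident_left_symm_snd (γ.rot (γ.rot (γ.rot d)))
    rw [γ.left_rot] at h2
    rw [hx'] at h1
    rw [hy'] at h2
    exact ⟨_, h1, h2⟩
  · have h1 := γ.incident_left_snd (γ.rot d)
    have h2 := γ.incident_left_symm_snd (γ.rot (γ.rot d))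
    rw [γ.left_rot, hx'] at h2
    rw [hz] at h1
    exact ⟨_, h2, h1⟩

/-- At a crossing on the cycle that is not on an edge `uv`, the two neighbours off the cycle are on
the same side. -/
theorem OnSide.of_common_crossing [Finite V] {t : ZMod 2} {q : X.Crossing}
    (hu : X.planarization.Adj (.inl C.u) (.inr q)) (hv : X.planarization.Adj (.inl C.v) (.inr q))
    (huv : s(C.u, C.v) ∉ q.1) {b b' : V ⊕ X.Crossing} (hb : C.Off b) (hb' : C.Off b')
    (hbq : X.planarization.Adj b (.inr q)) (hbq' : X.planarization.Adj b' (.inr q))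
    (h : γ.OnSide C t b) : γ.OnSide C t b' := by
  obtain ⟨x, y, hq⟩ := (crossing_cases C.u_ne_v hu hv).resolve_left huv
  obtain ⟨f, hfx, hfy⟩ := γ.exists_common_face hq
  rcases b with b | b
  swap
  · exact hbq.elim
  rcases b' with b' | b'
  swap
  · exact hbq'.elim
  rw [C.off_inl] at hb hb'
  rw [adj_iff_of_eq hq] at hbq hbq'
  have hb1 : b = x ∨ b = y := by tauto
  have hb2 : b' = x ∨ b' = y := by tauto
  have hb0 := (C.off_inl b').2 hb'
  rcases hb1 with rfl | rfl <;> rcases hb2 with rfl | rfl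
  · exact h
  · exact onSide_of_incident hb0 hfy (h _ hfx)
  · exact onSide_of_incident hb0 hfx (h _ hfy)
  · exact h

/-- An edge has at most one crossing, and `c ≠ s`. -/
theorem not_mem_or_not_mem (C : CrossingCycle X) :
    s(C.u, C.v) ∉ C.c.1 ∨ s(C.u, C.v) ∉ C.s.1 := by
  by_contra! h
  exact C.c_ne_s (eq_of_mem_of_mem h.1 h.2)

variable (γ C)

/-- The conditions for posi-cycles (`t = 1`) and for nega-cycles (`t = 0`). -/
def IsGood (t : ZMod 2) : Prop :=
  γ.IsClear C {f | γ.side C f = t} ∧ (γ.crossingNeighbors C {f | γ.side C f = t + 1}).Subsingleton ∧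
    γ.IsHardOn C {f | γ.side C f = t}

theorem side_one_set : {f | γ.side C f = 1} = γ.interior C := Set.ext fun _ => γ.side_eq_one C

theorem side_zero_set : {f | γ.side C f = 0} = γ.exterior C := Set.ext fun _ => γ.side_eq_zero C

theorem isPosi_iff : γ.IsPosi C ↔ γ.IsGood C 1 := by
  unfold IsPosi IsBCycle IsWCycle IsGood IsCandidatePosi
  rw [show (1 + 1 : ZMod 2) = 0 from rfl, side_one_set, side_zero_set, ← and_or_left, and_assoc]
  refine and_congr_right fun _ => and_congr_left fun _ => ?_
  constructor
  · rintro (⟨x, -, hx⟩ | h)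
    · exact fun a ha b hb => (hx a ha).trans (hx b hb).symm
    · rw [h]
      exact Set.subsingleton_empty
  · intro h
    rcases h.eq_empty_or_singleton with h | ⟨x, h⟩
    · exact .inr h
    · rw [h]
      exact .inl ⟨x, rfl, fun y hy => hy⟩

theorem isNega_iff : γ.IsNega C ↔ γ.IsGood C 0 := by
  unfold IsNega IsGood IsCandidateNega
  rw [zero_add, side_one_set, side_zero_set]

theorem vertexExt_iff (w : V ⊕ X.Crossing) :
    γ.VertexExt C.edges w ↔ C.Off w ∧ γ.OnSide C 0 w := by
  unfold VertexExt
  rw [show γ.extFaces C.edges = γ.exterior C from rfl, ← side_zero_set]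
  rfl

theorem vertexInt_iff (w : V ⊕ X.Crossing) :
    γ.VertexInt C.edges w ↔ C.Off w ∧ γ.OnSide C 1 w := by
  unfold VertexInt
  rw [show γ.intFaces C.edges = γ.interior C from rfl, ← side_one_set]
  rfl

variable {γ C}

theorem IsGood.exists_attached [Finite V] {t : ZMod 2} (h : γ.IsGood C t) :
    ∃ a, C.Attached a (.inr C.c) ∧ C.Attached a (.inr C.s) ∧ γ.OnSide C t a :=
  γ.exists_attached_of_hard C fun f hf hu hv => h.2.2 f hf ⟨hu, hv⟩

/-- The edge `uv` uses two of the four ends at `q`, and the connection reaches `q` through a third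
one, on side `t`. Only one end is left for the other side. -/
theorem eq_of_attached [Finite V] {t : ZMod 2} {a : V ⊕ X.Crossing} {q : X.Crossing}
    (hq : C.Attached a (.inr q)) (ha : γ.OnSide C t a) (huv : s(C.u, C.v) ∈ q.1) {x y : V}
    (hx : X.planarization.Adj (.inl x) (.inr q)) (hy : X.planarization.Adj (.inl y) (.inr q))
    (hxo : C.Off (.inl x)) (hyo : C.Off (.inl y)) (hxs : γ.OnSide C (t + 1) (.inl x))
    (hys : γ.OnSide C (t + 1) (.inl y)) : x = y := by
  obtain ⟨hoff, b, hab, hbq⟩ := hq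
  rcases b with b | b
  swap
  · exact hbq.elim
  have hbo := hab.off hoff
  have hbs := ha.of_joined hab
  have hne : t ≠ t + 1 := by
    clear * -
    revert t
    decide
  have hbx : b ≠ x := fun h => hne (hbs.unique (h ▸ hxs))
  have hby : b ≠ y := fun h => hne (hbs.unique (h ▸ hys))
  obtain ⟨e', he'⟩ := huv
  have mem : ∀ z, C.Off (.inl z) → X.planarization.Adj (.inl z) (.inr q) → z ∈ e' := by
    intro z hz hzq
    rw [C.off_inl] at hz
    obtain ⟨e, he, hze⟩ := hzq
    rw [he', Sym2.mem_iff] at he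
    rcases he with rfl | rfl
    · rw [Sym2.mem_iff] at hze
      tauto
    · exact hze
  obtain ⟨p, rfl⟩ := mem b hbo hbq
  have h1 := mem x hxo hx
  have h2 := mem y hyo hy
  rw [Sym2.mem_iff] at h1 h2
  rw [h1.resolve_left hbx.symm, h2.resolve_left hby.symm]

/-- The kind of a cycle in another cross-preserving embedding is determined by the side of the
connection between `c` and `s`. -/
theorem IsGood.transfer [Finite V] {γ' : OnePlaneEmbedding X} {t t' : ZMod 2} {a : V ⊕ X.Crossing}
    (h : γ.IsGood C t) (hac : C.Attached a (.inr C.c)) (has : C.Attached a (.inr C.s))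
    (ha : γ.OnSide C t a) (ha' : γ'.OnSide C t' a) : γ'.IsGood C t' := by
  have hard : γ'.IsHardOn C {f | γ'.side C f = t'} := fun f hf hfuv =>
    γ'.not_linked_of_attached C hac has ha' hf (.inl hfuv.1) (.inl hfuv.2)
  refine ⟨⟨?_, ?_⟩, ?_, hard⟩
  · rintro ⟨d, hu, hv, hl, -⟩
    exact hard _ hl ⟨hu ▸ γ'.incident_left_fst d, hv ▸ γ'.incident_left_snd d⟩
  · rintro ⟨q, hu, hv, hoff, hq⟩
    -- A crossing in the component of `a` was already on side `t` in `γ`, where this is excluded.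
    -- Any other one would link its faces to both `u` and `v`.
    by_cases hj : C.Joined a (.inr q)
    · exact h.1.2 ⟨q, hu, hv, hoff, ha.of_joined hj⟩
    · obtain ⟨f, hf⟩ := γ'.exists_incident (.inr q)
      exact γ'.not_linked_of_attached C hac has ha' (hq f hf)
        (.inr ⟨_, hf, hj, .of_adj hoff hu.symm⟩) (.inr ⟨_, hf, hj, .of_adj hoff hv.symm⟩)
  · have hne : t' ≠ t' + 1 := by
      clear * -
      revert t'
      decide
    -- At a crossing that is not on an edge `uv`, both neighbours off the cycle are on the side of
    -- `a`. So the other side can only have a neighbour of the one crossing, if any, that is on the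
    -- edge `uv`.
    have excl : ∀ (q : X.Crossing), C.Attached a (.inr q) →
        X.planarization.Adj (.inl C.u) (.inr q) → X.planarization.Adj (.inl C.v) (.inr q) →
        s(C.u, C.v) ∉ q.1 → ∀ x, C.Off (.inl x) → γ'.OnSide C (t' + 1) (.inl x) →
        ¬ X.planarization.Adj (.inl x) (.inr q) := by
      rintro q ⟨hoff, b, hab, hbq⟩ hu hv huv x hx hxs hxq
      exact hne ((OnSide.of_common_crossing hu hv huv (hab.off hoff) hx hbq hxq
        (ha'.of_joined hab)).unique hxs)
    rintro x ⟨-, -, hx, hxo, hxs⟩ y ⟨-, -, hy, hyo, hys⟩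
    change C.Off _ at hxo hyo
    change γ'.OnSide C _ _ at hxs hys
    rcases not_mem_or_not_mem C with hc | hs
    · have hx' := hx.resolve_left (excl _ hac C.adj_uc C.adj_cv.symm hc x hxo hxs)
      have hy' := hy.resolve_left (excl _ hac C.adj_uc C.adj_cv.symm hc y hyo hys)
      by_cases hs : s(C.u, C.v) ∈ C.s.1
      · exact eq_of_attached has ha' hs hx' hy' hxo hyo hxs hys
      · exact absurd hx' (excl _ has C.adj_su.symm C.adj_vs hs x hxo hxs)
    · have hx' := hx.resolve_right (excl _ has C.adj_su.symm C.adj_vs hs x hxo hxs)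
      have hy' := hy.resolve_right (excl _ has C.adj_su.symm C.adj_vs hs y hyo hys)
      by_cases hc : s(C.u, C.v) ∈ C.c.1
      · exact eq_of_attached hac ha' hc hx' hy' hxo hyo hxs hys
      · exact absurd hx' (excl _ hac C.adj_uc C.adj_cv.symm hc x hxo hxs)

/-- In a circular instance, some face is at both `u` and `v`. -/
theorem exists_face_of_isCircular [Finite V] (hX : X.IsCircular) (γ : OnePlaneEmbedding X)
    (C : CrossingCycle X) : ∃ f, γ.Incident (.inl C.u) f ∧ γ.Incident (.inl C.v) f := by
  -- At one of `c`, `s` the vertices `u` and `v` are ends of different edges, so circularity gives a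
  -- vertex `w` of degree 2 between them.
  have hq : ∃ (q : X.Crossing) (x y : V), q.1 = s(s(C.u, x), s(C.v, y)) := by
    rcases not_mem_or_not_mem C with h | h
    · exact ⟨_, (crossing_cases C.u_ne_v C.adj_uc C.adj_cv.symm).resolve_left h⟩
    · exact ⟨_, (crossing_cases C.u_ne_v C.adj_su.symm C.adj_vs).resolve_left h⟩
  obtain ⟨q, x, y, hq⟩ := hq
  obtain ⟨w, _, _, _, -, hdeg, huw, hwv, -⟩ := hX C.u C.v x y (hq ▸ q.2)
  have hN : G.neighborSet w = {C.u, C.v} := by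
    symm
    refine Set.eq_of_subset_of_ncard_le ?_ ?_ (Set.toFinite _)
    · rintro z (rfl | rfl)
      · exact huw.1.symm
      · exact hwv.1
    · rw [hdeg w (by simp), Set.ncard_pair C.u_ne_v]
  let du : X.planarization.Dart := ⟨(.inl w, .inl C.u), huw.symm⟩
  let dv : X.planarization.Dart := ⟨(.inl w, .inl C.v), hwv⟩
  have hduv : du ≠ dv := fun h => C.u_ne_v (Sum.inl_injective
    (congrArg (fun d : X.planarization.Dart => d.snd) h))
  have snd : ∀ d : X.planarization.Dart, d.fst = .inl w → d = du ∨ d = dv := by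
    rintro ⟨⟨a, b⟩, hab⟩ (rfl : a = _)
    rcases b with b | b
    · have : b ∈ G.neighborSet w := hab.1
      rw [hN] at this
      rcases this with rfl | rfl
      · exact .inl rfl
      · exact .inr rfl
    · exfalso
      obtain ⟨e, he, b', rfl⟩ := hab
      have : b' ∈ G.neighborSet w := X.edge_mem _ b.2 _ he
      rw [hN] at this
      rcases this with rfl | rfl
      · exact huw.symm.2 _ b.2 he
      · exact hwv.2 _ b.2 he
  -- The darts to `u` and `v` are the only ones at `w`, hence consecutive, and the face between them
  -- is at both `u` and `v`.
  have hrot : γ.rot du = dv := by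
    rcases snd (γ.rot du) (γ.rot_fst du) with h | h
    · exfalso
      exact hduv ((γ.rot_cyclic du dv rfl).eq_of_left h)
    · exact h
  refine ⟨γ.left du, γ.incident_left_snd du, ?_⟩
  rw [← γ.left_rot, hrot]
  exact γ.incident_left_symm_snd dv

/-- The face at both `u` and `v` given by circularity is on one of the sides, so only the other side
can be hard. -/
theorem not_isGood_both [Finite V] (hX : X.IsCircular) {t t' : ZMod 2} (h : γ.IsGood C t)
    (h' : γ.IsGood C t') : t = t' := by
  obtain ⟨f, hf⟩ := exists_face_of_isCircular hX γ C
  have h1 : γ.side C f ≠ t := fun he => h.2.2 f he hf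
  have h2 : γ.side C f ≠ t' := fun he => h'.2.2 f he hf
  generalize γ.side C f = s at h1 h2
  clear * - h1 h2
  revert s t t'
  decide

theorem HasPath.attached {S : Set γ.Face} {z x : V} (h : γ.HasPath C S z x) (hzx : z ≠ x) :
    C.Attached (.inl z) (.inl x) ∧ γ.VertexIn C.edges S (.inl z) := by
  obtain ⟨p, -, hp⟩ := h
  have hne : (Sum.inl z : V ⊕ X.Crossing) ≠ .inl x := fun h => hzx (Sum.inl_injective h)
  exact ⟨.of_walk p (fun w hw hwx => (hp w hw hwx).1) hne, hp _ p.start_mem_support hne⟩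

/-- The vertex `z` is not `u`, because the path to `v` starts at `z` and is off the cycle there;
likewise it is not `v`. -/
theorem attached_of_hasPath {S : Set γ.Face} {z : V} (hu : γ.HasPath C S z C.u)
    (hv : γ.HasPath C S z C.v) : C.Attached (.inl z) (.inl C.u) ∧ C.Attached (.inl z) (.inl C.v) ∧
      γ.VertexIn C.edges S (.inl z) := by
  have hzu : z ≠ C.u := by
    rintro rfl
    exact ((C.off_inl _).1 (hv.attached C.u_ne_v).2.1).1 rfl
  have hzv : z ≠ C.v := by
    rintro rfl
    exact ((C.off_inl _).1 (hu.attached C.u_ne_v.symm).2.1).2 rfl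
  exact ⟨(hu.attached hzu).1, hv.attached hzv⟩

theorem IsInFactor.exists_isGood {z : V} (h : γ.IsInFactor C z) :
    ∃ t, γ.IsGood C t ∧ C.Attached (.inl z) (.inl C.u) ∧ C.Attached (.inl z) (.inl C.v) ∧
      γ.OnSide C (t + 1) (.inl z) := by
  rcases h with ⟨hg, hu, hv⟩ | ⟨hg, hu, hv⟩
  · obtain ⟨h1, h2, h3⟩ := attached_of_hasPath hu hv
    exact ⟨1, (γ.isPosi_iff C).1 hg, h1, h2, ((γ.vertexExt_iff C _).1 h3).2⟩
  · obtain ⟨h1, h2, h3⟩ := attached_of_hasPath hu hv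
    exact ⟨0, (γ.isNega_iff C).1 hg, h1, h2, ((γ.vertexInt_iff C _).1 h3).2⟩

/-- In `γ` the in-factor is opposite to the connection `a`, hence in another component off the
cycle. On the same side as `a` in `γ'`, it would link its faces to both `u` and `v`. So it is
opposite to `a` there too, and the side of `a` decides the kind. -/
theorem isGood_iff_of_isInFactor [Finite V] (hX : X.IsCircular) {z : V} (h : γ.IsInFactor C z)
    (γ' : OnePlaneEmbedding X) (t : ZMod 2) :
    γ'.IsGood C t ↔ γ'.OnSide C (t + 1) (.inl z) := by
  obtain ⟨t₀, hg, hu, hv, hz⟩ := h.exists_isGood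
  obtain ⟨a, hac, has, ha⟩ := hg.exists_attached
  obtain ⟨t₁, ha'⟩ := exists_onSide (γ := γ') hac.1
  obtain ⟨t₂, hz'⟩ := exists_onSide (γ := γ') hu.1
  have hne : ∀ t : ZMod 2, t ≠ t + 1 := by decide
  have hnj : ¬ C.Joined a (.inl z) := fun hj => hne t₀ ((ha.of_joined hj).unique hz)
  obtain ⟨f, hf⟩ := γ'.exists_incident (.inl z)
  have h12 : t₁ ≠ t₂ := by
    rintro rfl
    exact γ'.not_linked_of_attached C hac has ha' (hz' f hf) (.inr ⟨_, hf, hnj, hu⟩)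
      (.inr ⟨_, hf, hnj, hv⟩)
  have hg' := hg.transfer hac has ha ha'
  have key : ∀ a b : ZMod 2, a ≠ b → b = a + 1 := by decide
  constructor
  · intro h
    rw [not_isGood_both hX h hg', ← key t₁ t₂ h12]
    exact hz'
  · intro h
    have : t = t₁ := by
      have e := h.unique hz'
      rw [key t₁ t₂ h12] at e
      exact add_right_cancel e
    rwa [this]

theorem isPosi_iff_vertexExt [Finite V] (hX : X.IsCircular) {z : V} (h : γ.IsInFactor C z)
    (γ' : OnePlaneEmbedding X) : γ'.IsPosi C ↔ γ'.VertexExt C.edges (.inl z) := by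
  rw [isPosi_iff, isGood_iff_of_isInFactor hX h, vertexExt_iff]
  obtain ⟨-, -, hu, -⟩ := h.exists_isGood
  exact (and_iff_right hu.1).symm

theorem isNega_iff_vertexInt [Finite V] (hX : X.IsCircular) {z : V} (h : γ.IsInFactor C z)
    (γ' : OnePlaneEmbedding X) : γ'.IsNega C ↔ γ'.VertexInt C.edges (.inl z) := by
  rw [isNega_iff, isGood_iff_of_isInFactor hX h, vertexInt_iff]
  obtain ⟨-, -, hu, -⟩ := h.exists_isGood
  exact (and_iff_right hu.1).symm

/-! ### Forbidden pairs -/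

variable {C' : CrossingCycle X}

theorem HasLink.attached {S : Set γ.Face} {x x' : V} (h : γ.HasLink C C' S x x') :
    (x' = x ∨ C.Attached (.inl x') (.inl x)) ∧ (x = x' ∨ C'.Attached (.inl x) (.inl x')) := by
  obtain ⟨p, -, h1, h2⟩ := h
  by_cases hx : x = x'
  · exact ⟨.inl hx.symm, .inl hx⟩
  · have hne : (Sum.inl x : V ⊕ X.Crossing) ≠ .inl x' := fun h => hx (Sum.inl_injective h)
    exact ⟨.inr (.of_walk p.reverse (fun w hw hwx => (h1 w (by simpa using hw) hwx).1) hne.symm),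
      .inr (.of_walk p (fun w hw hwx => (h2 w hw hwx).1) hne)⟩

theorem exists_dart_of_not_off {w : V ⊕ X.Crossing} (hw : ¬ C.Off w) :
    ∃ d : X.planarization.Dart, d.edge ∈ C.edges ∧ d.fst = w := by
  have : w = .inl C.u ∨ w = .inl C.v ∨ w = .inr C.c ∨ w = .inr C.s := by
    rw [C.off_iff] at hw
    tauto
  rcases this with rfl | rfl | rfl | rfl
  · exact ⟨⟨(_, _), C.adj_uc⟩, (C.edge_mem_iff _).2 (by simp), rfl⟩
  · exact ⟨⟨(_, _), C.adj_vs⟩, (C.edge_mem_iff _).2 (by simp), rfl⟩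
  · exact ⟨⟨(_, _), C.adj_cv⟩, (C.edge_mem_iff _).2 (by simp), rfl⟩
  · exact ⟨⟨(_, _), C.adj_su⟩, (C.edge_mem_iff _).2 (by simp), rfl⟩

/-- If the side `t` of `C` and the side `t'` of `C'` have no face in common in `γ`, and `C'` is
linked to `C`, then in every embedding the vertices of `C'` are not on the side of `C` on which `c`
and `s` are connected. -/
theorem not_onSide_of_linked [Finite V] {γ' : OnePlaneEmbedding X} {t t' τ : ZMod 2}
    {a : V ⊕ X.Crossing} (hac : C.Attached a (.inr C.c)) (has : C.Attached a (.inr C.s))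
    (ha : γ.OnSide C t a) (hdis : ∀ f, γ.side C f = t → γ.side C' f ≠ t')
    (hu : C'.u = C.u ∨ C.Attached (.inl C'.u) (.inl C.u))
    (hv : C'.v = C.v ∨ C.Attached (.inl C'.v) (.inl C.v)) (ha' : γ'.OnSide C τ a)
    {w : V ⊕ X.Crossing} (hw' : ¬ C'.Off w) (hw : C.Off w) : ¬ γ'.OnSide C τ w := by
  have key : ∀ a b : ZMod 2, a ≠ b → a = b + 1 := by decide
  -- A cycle edge of `C'` at `w` has a face on side `t'` of `C'`, and by disjointness this face is
  -- not on side `t` of `C`.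
  have hwt : γ.OnSide C (t + 1) w := by
    obtain ⟨d, hd, rfl⟩ := exists_dart_of_not_off hw'
    have h1 := γ.coboundary_side C' hd
    simp only [coboundary] at h1
    have : γ.side C' (γ.left d) = t' ∨ γ.side C' (γ.left d.symm) = t' := by
      generalize γ.side C' (γ.left d) = x at *
      generalize γ.side C' (γ.left d.symm) = y at *
      clear * - h1
      revert x y t'
      decide
    rcases this with h | h
    · exact onSide_of_incident hw (γ.incident_left_fst d) (key _ _ fun h' => hdis _ h' h)
    · exact onSide_of_incident hw (γ.incident_left_symm_fst d) (key _ _ fun h' => hdis _ h' h)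
  have hne : t ≠ t + 1 := by
    clear * -
    revert t
    decide
  have att : ∀ (w : V ⊕ X.Crossing) (x x' : V), C.Off w →
      (x' = x ∨ C.Attached (.inl x') (.inl x)) → X.planarization.Adj w (.inl x') →
      C.Attached w (.inl x) := by
    rintro w x x' hw (rfl | h) hadj
    · exact .of_adj hw hadj
    · exact .of_joined (.of_adj hw h.1 hadj) hw h
  have attc : C.Off (.inr C'.c) → C.Attached (.inr C'.c) (.inl C.u) ∧
      C.Attached (.inr C'.c) (.inl C.v) := fun h =>
    ⟨att _ _ _ h hu C'.adj_uc.symm, att _ _ _ h hv C'.adj_cv⟩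
  have atts : C.Off (.inr C'.s) → C.Attached (.inr C'.s) (.inl C.u) ∧
      C.Attached (.inr C'.s) (.inl C.v) := fun h =>
    ⟨att _ _ _ h hu C'.adj_su, att _ _ _ h hv C'.adj_vs.symm⟩
  -- For `u'` and `v'` the walk to `u` and `v` goes through whichever of `c'`, `s'` is off `C`. If
  -- both are on `C`, they are `c` and `s`, and `x` would be on the side of the connection in `γ`.
  have atv : ∀ x : V, X.planarization.Adj (.inl x) (.inr C'.c) →
      X.planarization.Adj (.inl x) (.inr C'.s) → C.Off (.inl x) → γ.OnSide C (t + 1) (.inl x) →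
      C.Attached (.inl x) (.inl C.u) ∧ C.Attached (.inl x) (.inl C.v) := by
    intro x hxc hxs hx hxt
    by_cases hc : C.Off (.inr C'.c)
    · exact ⟨.of_joined (.of_adj hx hc hxc) hx (attc hc).1,
        .of_joined (.of_adj hx hc hxc) hx (attc hc).2⟩
    by_cases hs : C.Off (.inr C'.s)
    · exact ⟨.of_joined (.of_adj hx hs hxs) hx (atts hs).1,
        .of_joined (.of_adj hx hs hxs) hx (atts hs).2⟩
    exfalso
    rw [C.off_inr] at hc hs
    have hcs := C'.c_ne_s
    have hboth : X.planarization.Adj (.inl x) (.inr C.c) ∧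
        X.planarization.Adj (.inl x) (.inr C.s) := by
      by_cases h1 : C'.c = C.c
      · have h2 : C'.s = C.s := by
          by_contra h
          exact hs ⟨fun h' => hcs (h1.trans h'.symm), h⟩
        rw [← h1, ← h2]
        exact ⟨hxc, hxs⟩
      · have h2 : C'.c = C.s := by tauto
        have h3 : C'.s = C.c := by
          by_contra h
          exact hs ⟨h, fun h' => hcs (h2.trans h'.symm)⟩
        rw [← h2, ← h3]
        exact ⟨hxs, hxc⟩
    rcases not_mem_or_not_mem C with h | h
    · obtain ⟨hoff, b, hab, hb⟩ := hac
      exact hne ((OnSide.of_common_crossing C.adj_uc C.adj_cv.symm h (hab.off hoff) hx hb hboth.1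
        (ha.of_joined hab)).unique hxt)
    · obtain ⟨hoff, b, hab, hb⟩ := has
      exact hne ((OnSide.of_common_crossing C.adj_su.symm C.adj_vs h (hab.off hoff) hx hb hboth.2
        (ha.of_joined hab)).unique hxt)
  have hatt : C.Attached w (.inl C.u) ∧ C.Attached w (.inl C.v) := by
    have : w = .inl C'.u ∨ w = .inl C'.v ∨ w = .inr C'.c ∨ w = .inr C'.s := by
      rw [C'.off_iff] at hw'
      tauto
    rcases this with rfl | rfl | rfl | rfl
    · exact atv _ C'.adj_uc C'.adj_su.symm hw hwt
    · exact atv _ C'.adj_cv.symm C'.adj_vs hw hwt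
    · exact attc hw
    · exact atts hw
  have hnj : ¬ C.Joined a w := fun hj => hne ((ha.of_joined hj).unique hwt)
  intro hwτ
  obtain ⟨f, hf⟩ := γ'.exists_incident w
  exact γ'.not_linked_of_attached C hac has ha' (hwτ f hf) (.inr ⟨_, hf, hnj, hatt.1⟩)
    (.inr ⟨_, hf, hnj, hatt.2⟩)

/-- An edge of `C'` joins a vertex of `G` and a crossing. If both were on `C`, the edge would be one
of the four edges of `C`. -/
theorem off_of_edge_mem {d : X.planarization.Dart} (hd' : d.edge ∈ C'.edges)
    (hd : d.edge ∉ C.edges) :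
    (¬ C'.Off d.fst ∧ C.Off d.fst) ∨ (¬ C'.Off d.snd ∧ C.Off d.snd) := by
  have h1 : ¬ C'.Off d.fst := fun h => C'.not_mem_edges_of_off h hd'
  have h2 : ¬ C'.Off d.snd := fun h => C'.not_mem_edges_of_off_snd h hd'
  by_contra hcon
  have h3 : ¬ C.Off d.fst := fun h => hcon (.inl ⟨h1, h⟩)
  have h4 : ¬ C.Off d.snd := fun h => hcon (.inr ⟨h2, h⟩)
  obtain ⟨⟨a, b⟩, hab⟩ := d
  dsimp only at *
  rcases a with a | a <;> rcases b with b | b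
  · simpa using (C'.edge_mem_iff _).1 hd'
  · rw [C.off_inl] at h3
    rw [C.off_inr] at h4
    refine hd ((C.edge_mem_iff _).2 ?_)
    simp only [Sum.inl.injEq, Sum.inr.injEq, reduceCtorEq, or_self, false_and, or_false]
    tauto
  · rw [C.off_inr] at h3
    rw [C.off_inl] at h4
    refine hd ((C.edge_mem_iff _).2 ?_)
    simp only [Sum.inl.injEq, Sum.inr.injEq, reduceCtorEq, or_self, false_and, false_or]
    tauto
  · exact hab.elim

/-- A walk of faces in the exterior of `C` never crosses an edge of `C'`: such an edge would have an
end off `C` in that exterior. -/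
theorem exterior_subset [Finite V] {γ' : OnePlaneEmbedding X}
    (h : ∀ w, ¬ C'.Off w → C.Off w → ¬ γ'.OnSide C 0 w) : γ'.exterior C ⊆ γ'.exterior C' := by
  intro f hf
  change Relation.ReflTransGen _ _ _ at hf
  induction hf with
  | refl => exact Relation.ReflTransGen.refl
  | @tail b c hb hs ih =>
    obtain ⟨d, hd, rfl, rfl⟩ := hs
    refine Relation.ReflTransGen.tail ih ⟨d, fun hd' => ?_, rfl, rfl⟩
    have h0 : γ'.side C (γ'.left d) = 0 := (γ'.side_eq_zero C).2 hb
    rcases off_of_edge_mem hd' hd with ⟨h1, h2⟩ | ⟨h1, h2⟩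
    · exact h _ h1 h2 (onSide_of_incident h2 (γ'.incident_left_fst d) h0)
    · exact h _ h1 h2 (onSide_of_incident h2 (γ'.incident_left_snd d) h0)

/-- The edges of a cycle are those at which the side changes. -/
theorem edges_subset_of_exterior_eq [Finite V] (h : γ.exterior C = γ.exterior C') :
    C.edges ⊆ C'.edges := by
  have hside : γ.side C = γ.side C' := by
    unfold side
    rw [h]
  have main : ∀ d : X.planarization.Dart, d.edge ∈ C.edges → d.edge ∈ C'.edges := by
    intro d hd
    by_contra hd'
    have h1 := γ.coboundary_side C hd
    rw [hside, γ.coboundary_eq_zero (γ.side_left_eq C' hd')] at h1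
    exact absurd h1 (by decide)
  rintro e he
  have he' := he
  simp only [CrossingCycle.edges, Set.mem_insert_iff, Set.mem_singleton_iff] at he
  rcases he with rfl | rfl | rfl | rfl
  · exact main ⟨(_, _), C.adj_uc⟩ he'
  · exact main ⟨(_, _), C.adj_cv⟩ he'
  · exact main ⟨(_, _), C.adj_vs⟩ he'
  · exact main ⟨(_, _), C.adj_su⟩ he'

/-- Two linked cycles with disjoint hard sides do not both become nega-cycles. -/
theorem isPosi_or_isPosi [Finite V] (hX : X.IsCircular) {t t' : ZMod 2} (hC : γ.IsGood C t)
    (hC' : γ.IsGood C' t') (hdis : ∀ f, γ.side C f = t → γ.side C' f ≠ t')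
    (hu : C'.u = C.u ∨ C.Attached (.inl C'.u) (.inl C.u))
    (hv : C'.v = C.v ∨ C.Attached (.inl C'.v) (.inl C.v))
    (hu' : C.u = C'.u ∨ C'.Attached (.inl C.u) (.inl C'.u))
    (hv' : C.v = C'.v ∨ C'.Attached (.inl C.v) (.inl C'.v)) (γ' : OnePlaneEmbedding X) :
    γ'.IsPosi C ∨ γ'.IsPosi C' := by
  obtain ⟨a, hac, has, ha⟩ := hC.exists_attached
  obtain ⟨b, hbc, hbs, hb⟩ := hC'.exists_attached
  obtain ⟨τ, ha'⟩ := exists_onSide (γ := γ') hac.1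
  obtain ⟨τ', hb'⟩ := exists_onSide (γ := γ') hbc.1
  have zo : ∀ x : ZMod 2, x ≠ 1 → x = 0 := by decide
  rw [isPosi_iff, isPosi_iff]
  by_cases hτ : τ = 1
  · exact .inl (hτ ▸ hC.transfer hac has ha ha')
  by_cases hτ' : τ' = 1
  · exact .inr (hτ' ▸ hC'.transfer hbc hbs hb hb')
  exfalso
  obtain rfl := zo τ hτ
  obtain rfl := zo τ' hτ'
  -- Both connections are now in the exteriors, so neither cycle has a vertex in the exterior of the
  -- other.
  have e : γ'.exterior C = γ'.exterior C' := by
    refine Set.Subset.antisymm (exterior_subset fun w h1 h2 => ?_)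
      (exterior_subset fun w h1 h2 => ?_)
    · exact not_onSide_of_linked hac has ha hdis hu hv ha' h1 h2
    · exact not_onSide_of_linked hbc hbs hb (fun f h h' => hdis f h' h) hu' hv' hb' h1 h2
  have he : C.edges = C'.edges :=
    (edges_subset_of_exterior_eq e).antisymm (edges_subset_of_exterior_eq e.symm)
  have hside : γ.side C = γ.side C' := by
    unfold side exterior
    rw [he]
  have huv : ∀ x, x = C.u ∨ x = C.v ↔ x = C'.u ∨ x = C'.v := by
    intro x
    have : C.Off (.inl x) ↔ C'.Off (.inl x) := by
      unfold CrossingCycle.Off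
      rw [he]
    rw [C.off_inl, C'.off_inl] at this
    clear * - this
    tauto
  -- Back in `γ`: the cycles have the same edges and their hard sides are disjoint, so these are the
  -- two sides of one cycle, and no side is left for the face at both `u` and `v`.
  have tt' : t' = t + 1 := by
    have h1 := γ.coboundary_side C (d := ⟨(_, _), C.adj_uc⟩) ((C.edge_mem_iff _).2 (by simp))
    have d1 := hdis (γ.left ⟨(_, _), C.adj_uc⟩)
    have d2 := hdis (γ.left (SimpleGraph.Dart.symm ⟨(_, _), C.adj_uc⟩))
    rw [← hside] at d1 d2
    have aux : ∀ x y t t' : ZMod 2, x + y = 1 → (x = t → x ≠ t') → (y = t → y ≠ t') →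
        t' = t + 1 := by decide
    exact aux _ _ _ _ h1 d1 d2
  obtain ⟨f, hf⟩ := exists_face_of_isCircular hX γ C
  have h1 : γ.side C f ≠ t := fun he => hC.2.2 f he hf
  have hf' : γ.Incident (.inl C'.u) f ∧ γ.Incident (.inl C'.v) f := by
    constructor
    · rcases (huv C'.u).2 (.inl rfl) with h | h
      · exact h ▸ hf.1
      · exact h ▸ hf.2
    · rcases (huv C'.v).2 (.inr rfl) with h | h
      · exact h ▸ hf.1
      · exact h ▸ hf.2
  have h2 : γ.side C f ≠ t' := fun he => hC'.2.2 f (by rw [← hside]; exact he) hf'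
  have aux : ∀ x t : ZMod 2, x ≠ t → x = t + 1 := by decide
  exact h2 (tt' ▸ aux _ _ h1)

/-- Both cases say that the hard sides have no common face; for a nega-cycle `C'` the hard side is
its exterior. -/
theorem IsForbiddenPair.isPosi_or_isPosi [Finite V] (hX : X.IsCircular)
    (h : γ.IsForbiddenPair C C') (γ' : OnePlaneEmbedding X) : γ'.IsPosi C ∨ γ'.IsPosi C' := by
  obtain ⟨hC, ⟨hC', hdis, hu, hv⟩ | ⟨hC', hsub, hu, hv⟩⟩ := h
  · refine OnePlaneEmbedding.isPosi_or_isPosi hX ((γ.isPosi_iff C).1 hC) ((γ.isPosi_iff C').1 hC')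
      ?_ hu.attached.1 hv.attached.1 hu.attached.2 hv.attached.2 γ'
    intro f h1 h2
    exact Set.disjoint_left.1 hdis ((γ.side_eq_one C).1 h1) ((γ.side_eq_one C').1 h2)
  · refine OnePlaneEmbedding.isPosi_or_isPosi hX ((γ.isPosi_iff C).1 hC) ((γ.isNega_iff C').1 hC')
      ?_ hu.attached.1 hv.attached.1 hu.attached.2 hv.attached.2 γ'
    intro f h1 h2
    exact hsub ((γ.side_eq_one C).1 h1) ((γ.side_eq_zero C').1 h2)

/-! ### B- and W-configurations -/

/-- At a crossing of a posi-cycle that is not on an edge `uv`, the two neighbours off the cycle are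
in the interior. -/
theorem IsGood.vertexInt [Finite V] (h : γ.IsGood C 1) {q : X.Crossing} (hqC : q = C.c ∨ q = C.s)
    {x y : V} (hq : q.1 = s(s(C.u, x), s(C.v, y))) :
    γ.VertexInt C.edges (.inl x) ∧ γ.VertexInt C.edges (.inl y) := by
  have hne := ne_of_eq hq
  have hx : C.Off (.inl x) := (C.off_inl x).2 ⟨hne.1.symm, hne.2.2.2.2.1⟩
  have hy : C.Off (.inl y) := (C.off_inl y).2 ⟨hne.2.2.2.1.symm, hne.2.1.symm⟩
  obtain ⟨f, hfx, hfy⟩ := γ.exists_common_face hq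
  have hsx := onSide_of_incident hx hfx rfl
  have hsy := onSide_of_incident hy hfy rfl
  have key : ∀ t : ZMod 2, t = 1 ∨ t = 0 := by decide
  rcases key (γ.side C f) with hf | hf
  · rw [hf] at hsx hsy
    rw [vertexInt_iff, vertexInt_iff]
    exact ⟨⟨hx, hsx⟩, hy, hsy⟩
  · exfalso
    rw [hf] at hsx hsy
    have adj : ∀ z, (z = x ∨ z = y) → X.planarization.Adj (.inl z) (.inr C.c) ∨
        X.planarization.Adj (.inl z) (.inr C.s) := by
      intro z hz
      have : X.planarization.Adj (.inl z) (.inr q) := (adj_iff_of_eq hq z).2 (by tauto)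
      rcases hqC with rfl | rfl
      · exact .inl this
      · exact .inr this
    -- In the exterior, `x` and `y` would be two vertices where at most one is allowed.
    exact hne.2.2.2.2.2 (h.2.1
      ⟨((C.off_inl x).1 hx).1, ((C.off_inl x).1 hx).2, adj x (.inl rfl), hx, hsx⟩
      ⟨((C.off_inl y).1 hy).1, ((C.off_inl y).1 hy).2, adj y (.inr rfl), hy, hsy⟩)

/-- If the edge `uv` is crossed at `c`, its two halves are the cycle edges at `c`, so the closed
curve of the B-configuration at `s` is the cycle itself. -/
theorem edges_eq_trace (h : s(C.u, C.v) ∈ C.c.1) :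
    {s(.inl C.u, .inr C.s), s(.inr C.s, .inl C.v)} ∪ X.trace s(C.u, C.v) = C.edges := by
  have ht : X.trace s(C.u, C.v) = {s(.inl C.u, .inr C.c), s(.inl C.v, .inr C.c)} := by
    ext b
    constructor
    · rintro (⟨x, y, hxy, hadj, -⟩ | ⟨c', hc', x, hx, rfl⟩)
      · exact absurd (hxy ▸ h) (hadj.2 _ C.c.2)
      · obtain rfl := eq_of_mem_of_mem h hc'
        rcases Sym2.mem_iff.1 hx with rfl | rfl
        · exact .inl rfl
        · exact .inr rfl
    · rintro (rfl | rfl)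
      · exact .inr ⟨C.c, h, C.u, by simp, rfl⟩
      · exact .inr ⟨C.c, h, C.v, by simp, rfl⟩
  rw [ht]
  ext b
  simp only [CrossingCycle.edges, Set.mem_union, Set.mem_insert_iff, Set.mem_singleton_iff]
  rw [show s(Sum.inl C.u, Sum.inr C.s) = s(Sum.inr C.s, Sum.inl C.u) from Sym2.eq_swap,
    show s(Sum.inl C.v, Sum.inr C.s) = s(Sum.inr C.s, Sum.inl C.v) from Sym2.eq_swap,
    show s(Sum.inl C.v, Sum.inr C.c) = s(Sum.inr C.c, Sum.inl C.v) from Sym2.eq_swap]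
  tauto

/-- If `c` or `s` is on an edge `uv`, this edge is the middle edge of a B-configuration at the other
crossing. Otherwise each crossing is made by an edge at `u` and an edge at `v`, as in a
W-configuration. -/
theorem IsPosi.hasConfiguration [Finite V] (h : γ.IsPosi C) :
    γ.HasBConfiguration ∨ γ.HasWConfiguration := by
  rw [isPosi_iff] at h
  rcases crossing_cases C.u_ne_v C.adj_uc C.adj_cv.symm with hc | ⟨x, y, hc⟩
  · left
    have hs : s(C.u, C.v) ∉ C.s.1 := fun hs => C.c_ne_s (eq_of_mem_of_mem hc hs)
    obtain ⟨x, y, hs⟩ := (crossing_cases C.u_ne_v C.adj_su.symm C.adj_vs).resolve_left hs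
    have hint := h.vertexInt (.inr rfl) hs
    refine ⟨x, C.u, C.v, y, C.s, ?_, X.edge_mem _ C.c.2 _ hc, ?_⟩
    · rw [hs, show s(C.u, x) = s(x, C.u) from Sym2.eq_swap]
    · rw [edges_eq_trace hc]
      exact hint
  · have hcint := h.vertexInt (.inl rfl) hc
    rcases crossing_cases C.u_ne_v C.adj_su.symm C.adj_vs with hs | ⟨x', y', hs⟩
    · left
      refine ⟨x, C.u, C.v, y, C.c, ?_, X.edge_mem _ C.s.2 _ hs, ?_⟩
      · rw [hc, show s(C.u, x) = s(x, C.u) from Sym2.eq_swap]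
      · have := edges_eq_trace (C := C.swap) hs
        rw [CrossingCycle.swap_edges] at this
        simp only [CrossingCycle.swap] at this
        rw [this]
        exact hcint
    · right
      have hsint := h.vertexInt (.inr rfl) hs
      refine ⟨x, C.u, x', y', C.v, y, C.c, C.s, C.c_ne_s, ?_, ?_, ?_⟩
      · rw [hc, show s(C.u, x) = s(x, C.u) from Sym2.eq_swap]
      · rw [hs, show s(C.v, y') = s(y', C.v) from Sym2.eq_swap]
      · intro z hz
        simp only [List.mem_cons, List.not_mem_nil, or_false] at hz
        rcases hz with rfl | rfl | rfl | rfl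
        · exact hcint.1
        · exact hsint.1
        · exact hsint.2
        · exact hcint.2

end OnePlaneEmbedding

/-! ### Plane geometry -/

section Geometry

/-- Write `c = a s + b p` and `s = a' c + b' p'` with `p`, `p'` on the segment `uv`. Substitution
makes `c` a convex combination of `p` and `p'` unless `a a' = 1`, and then `c = s`. -/
theorem mem_segment_of_mem_convexHull {E : Type*} [AddCommGroup E] [Module ℝ E] {u v c s : E}
    (hcs : c ≠ s) (hc : c ∈ convexHull ℝ {s, u, v}) (hs : s ∈ convexHull ℝ {c, u, v}) :
    c ∈ segment ℝ u v := by
  rw [convexHull_insert (by simp), convexJoin_singleton_left, Set.mem_iUnion₂] at hc hs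
  obtain ⟨p, hp, a, b, ha, hb, hab, hc⟩ := hc
  obtain ⟨p', hp', a', b', ha', hb', hab', hs⟩ := hs
  rw [convexHull_pair] at hp hp'
  have h1 : a * a' ≤ 1 := by nlinarith
  rcases h1.lt_or_eq with h1 | h1
  · have h0 : 0 < 1 - a * a' := by linarith
    have key : (1 - a * a') • c = (a * b') • p' + b • p := by
      have : c = a • (a' • c + b' • p') + b • p := by rw [hs, hc]
      rw [sub_smul, one_smul]
      nth_rewrite 1 [this]
      module
    have hcp : c = (a * b' / (1 - a * a')) • p' + (b / (1 - a * a')) • p := by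
      have : c = (1 - a * a')⁻¹ • ((1 - a * a') • c) := by
        rw [smul_smul, inv_mul_cancel₀ h0.ne', one_smul]
      rw [this, key]
      module
    rw [hcp]
    refine convex_segment u v hp' hp (by positivity) (by positivity) ?_
    rw [← add_div, div_eq_one_iff_eq h0.ne']
    have : b' = 1 - a' := by linarith
    rw [this]
    linarith
  · exfalso
    have ha1 : a = 1 := by nlinarith
    have hb0 : b = 0 := by linarith
    rw [ha1, hb0, one_smul, zero_smul, add_zero] at hc
    exact hcs hc.symm

theorem mem_segment_or_mem_segment {E : Type*} [AddCommGroup E] [Module ℝ E] {u v c s : E}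
    (hc : c ∈ segment ℝ u v) (hs : s ∈ segment ℝ u v) :
    c ∈ segment ℝ u s ∨ s ∈ segment ℝ u c := by
  have aux : ∀ l m : ℝ, 0 ≤ l → l ≤ m → u + l • (v - u) ∈ segment ℝ u (u + m • (v - u)) := by
    intro l m hl hlm
    rw [segment_eq_image']
    rcases (hl.trans hlm).eq_or_lt with h | h
    · refine ⟨0, by simp, ?_⟩
      have : l = 0 := by linarith
      simp [this]
    · refine ⟨l / m, ⟨by positivity, (div_le_one h).2 hlm⟩, ?_⟩
      simp only [add_sub_cancel_left, smul_smul, div_mul_cancel₀ _ h.ne']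
  rw [segment_eq_image'] at hc hs
  obtain ⟨l, hl, rfl⟩ := hc
  obtain ⟨m, hm, rfl⟩ := hs
  rcases le_total l m with h | h
  · exact .inl (aux l m hl.1 h)
  · exact .inr (aux m l hm.1 h)

/-- A point outside a convex hull of finitely many points is strictly separated from them by a real
linear function, written as the real part of a multiplication. -/
theorem exists_separating {S : Set ℂ} (hS : S.Finite) {c : ℂ} (hc : c ∉ convexHull ℝ S) :
    ∃ m : ℂ, ∀ z ∈ S, (m * z).re < (m * c).re := by
  obtain ⟨l, k, h1, h2⟩ := geometric_hahn_banach_closed_point (convex_convexHull ℝ S)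
    (hS.isClosed_convexHull ℝ) hc
  have hl : ∀ z : ℂ, ((l 1 - l Complex.I * Complex.I) * z).re = l z := by
    intro z
    have hz : z = z.re • (1 : ℂ) + z.im • Complex.I := by
      apply Complex.ext <;> simp
    conv_rhs => rw [hz, map_add, map_smul, map_smul]
    simp [Complex.mul_re]
    ring
  refine ⟨l 1 - l Complex.I * Complex.I, fun z hz => ?_⟩
  rw [hl, hl]
  exact (h1 z (subset_convexHull ℝ S hz)).trans h2

/-- An open half-plane without finitely many points is connected. -/
theorem isPreconnected_halfPlane_diff {m : ℂ} (hm : m ≠ 0) (k : ℝ) {S : Set ℂ} (hS : S.Countable) :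
    IsPreconnected ({z : ℂ | k < (m * z).re} \ S) := by
  -- A continuous bijection from the plane to the half-plane; the plane without a countable set is
  -- connected.
  let f : ℂ → ℂ := fun w => (k + Real.exp w.re + w.im * Complex.I) / m
  have hmf : ∀ w, m * f w = k + Real.exp w.re + w.im * Complex.I := by
    intro w
    simp only [f]
    field_simp
  have hre : ∀ w, (m * f w).re = k + Real.exp w.re := by
    intro w
    rw [hmf]
    simp [Complex.exp_ofReal_re]
  have him : ∀ w, (m * f w).im = w.im := by
    intro w
    rw [hmf]
    simp [Complex.exp_ofReal_im]
  have hinj : Function.Injective f := by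
    intro w w' h
    have h1 := hre w
    have h2 := him w
    rw [h, hre] at h1
    rw [h, him] at h2
    exact Complex.ext (Real.exp_injective (by linarith)) h2.symm
  have hcont : Continuous f := by
    simp only [f]
    fun_prop
  have himage : {z : ℂ | k < (m * z).re} \ S = f '' (f ⁻¹' S)ᶜ := by
    ext z
    constructor
    · rintro ⟨hz, hzS⟩
      have hz' : 0 < (m * z).re - k := by
        simp only [Set.mem_ofPred_eq] at hz
        linarith
      have hfz : f ⟨Real.log ((m * z).re - k), (m * z).im⟩ = z := by
        apply mul_left_cancel₀ hm
        apply Complex.ext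
        · rw [hre, Real.exp_log hz']
          ring
        · rw [him]
      exact ⟨_, fun h => hzS (by rwa [Set.mem_preimage, hfz] at h), hfz⟩
    · rintro ⟨w, hw, rfl⟩
      refine ⟨?_, hw⟩
      simp only [Set.mem_ofPred_eq]
      rw [hre]
      linarith [Real.exp_pos w.re]
  rw [himage]
  refine IsPreconnected.image ?_ _ hcont.continuousOn
  refine (Set.Countable.isConnected_compl_of_one_lt_rank ?_ (hS.preimage hinj)).isPreconnected
  rw [Complex.rank_real_complex]
  exact Nat.one_lt_ofNat

/-- The exponential maps the half-plane `Re w > log R` onto this set. -/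
theorem isPreconnected_lt_norm {R : ℝ} (hR : 0 < R) : IsPreconnected {z : ℂ | R < ‖z‖} := by
  have : {z : ℂ | R < ‖z‖} = Complex.exp '' {w : ℂ | Real.log R < w.re} := by
    ext z
    constructor
    · intro hz
      have hz0 : z ≠ 0 := by
        rintro rfl
        simp only [Set.mem_ofPred_eq, norm_zero] at hz
        linarith
      exact ⟨Complex.log z, by simpa [Complex.log_re] using Real.log_lt_log hR hz, Complex.exp_log hz0⟩
    · rintro ⟨w, hw, rfl⟩
      simp only [Set.mem_ofPred_eq] at hw ⊢
      rw [Complex.norm_exp]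
      exact (Real.log_lt_iff_lt_exp hR).1 hw
  rw [this]
  exact (convex_halfSpace_re_gt _).isPreconnected.image _ Complex.continuous_exp.continuousOn

end Geometry

/-! ### Straight-line drawings -/

namespace OnePlaneEmbedding.StraightLineDrawing

open Filter Topology Set PlaneEmbedding CrossingSystem

variable {γ : OnePlaneEmbedding X} (D : γ.StraightLineDrawing)

theorem pos_ne (d : X.planarization.Dart) : D.pos d.snd - D.pos d.fst ≠ 0 :=
  sub_ne_zero.2 fun h => d.snd_ne_fst (D.pos_injective h)

theorem segment_subset (d : X.planarization.Dart) :
    segment ℝ (D.pos d.fst) (D.pos d.snd) ⊆ pointSet X D.pos :=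
  fun _ hz => .inr (mem_iUnion.2 ⟨d, hz⟩)

theorem isCompact_segment (a b : ℂ) : IsCompact (segment ℝ a b) := by
  rw [segment_eq_image']
  exact isCompact_Icc.image (by fun_prop)

theorem isCompact_pointSet [Finite V] : IsCompact (pointSet X D.pos) :=
  (finite_range _).isCompact.union (isCompact_iUnion fun _ => isCompact_segment _ _)

theorem region_subset (f : γ.Face) : D.region f ⊆ (pointSet X D.pos)ᶜ := by
  obtain ⟨z, -, h⟩ := D.region_component f
  rw [h]
  exact connectedComponentIn_subset _ _

theorem isOpen_region [Finite V] (f : γ.Face) : IsOpen (D.region f) := by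
  obtain ⟨z, -, h⟩ := D.region_component f
  rw [h]
  exact D.isCompact_pointSet.isClosed.isOpen_compl.connectedComponentIn

theorem region_eq {f : γ.Face} {z : ℂ} (hz : z ∈ D.region f) :
    D.region f = connectedComponentIn (pointSet X D.pos)ᶜ z := by
  obtain ⟨z', -, h⟩ := D.region_component f
  rw [h] at hz ⊢
  exact connectedComponentIn_eq hz

theorem subset_region {f : γ.Face} {S : Set ℂ} (hS : IsPreconnected S)
    (hS' : S ⊆ (pointSet X D.pos)ᶜ) {z : ℂ} (hz : z ∈ S) (hzf : z ∈ D.region f) :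
    S ⊆ D.region f := by
  rw [D.region_eq hzf]
  exact hS.subset_connectedComponentIn hz hS'

theorem face_eq {f g : γ.Face} {z : ℂ} (hf : z ∈ D.region f) (hg : z ∈ D.region g) : f = g :=
  D.region_injective ((D.region_eq hf).trans (D.region_eq hg).symm)

/-- Near an inner point of an edge, the points on the left of the edge belong to the face on its
left. -/
theorem eventually_mem_region [Finite V] (d : X.planarization.Dart) {z : ℂ}
    (hz : z ∈ openSegment ℝ (D.pos d.fst) (D.pos d.snd)) :
    ∀ᶠ y in 𝓝 z, 0 < ((y - D.pos d.fst) / (D.pos d.snd - D.pos d.fst)).im →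
      y ∈ D.region (γ.left d) := by
  have hab := D.pos_ne d
  set a := D.pos d.fst with ha
  set b := D.pos d.snd with hb
  let φ : ℂ → ℂ := fun w => a + w * (b - a)
  have hφc : Continuous φ := by
    simp only [φ]
    fun_prop
  have hφinj : Function.Injective φ := fun w w' h =>
    mul_right_cancel₀ hab (add_left_cancel h)
  have hφψ : ∀ y, φ ((y - a) / (b - a)) = y := by
    intro y
    simp only [φ]
    field_simp
    ring
  have hφreal : ∀ x : ℝ, φ x = a + x • (b - a) := fun x => by simp [φ]
  have hφ0 : φ 0 = a := by simp [φ]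
  have hφ1 : φ 1 = b := by simp [φ]
  -- The drawing without the inside of the edge `d`. In the coordinate `φ` this edge is the real
  -- interval from `0` to `1`.
  let O : Set ℂ := range D.pos ∪ ⋃ d' : {d' : X.planarization.Dart // d'.edge ≠ d.edge},
    segment ℝ (D.pos d'.1.fst) (D.pos d'.1.snd)
  have hO : IsClosed O := ((finite_range _).isCompact.union
    (isCompact_iUnion fun _ => isCompact_segment _ _)).isClosed
  have hends : ∀ x : ℝ, 0 < x → x < 1 → ∀ w, (w = d.fst ∨ w = d.snd) → D.pos w ≠ φ x := by
    rintro x h0 h1 w (rfl | rfl) h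
    · rw [← ha, ← hφ0] at h
      have := hφinj h
      rw [eq_comm, Complex.ofReal_eq_zero] at this
      exact h0.ne' this
    · rw [← hb, ← hφ1] at h
      have := hφinj h
      rw [eq_comm, Complex.ofReal_eq_one] at this
      exact h1.ne this
  have hφO : ∀ x : ℝ, 0 < x → x < 1 → φ x ∉ O := by
    intro x h0 h1 hx
    have hseg : φ x ∈ segment ℝ a b := by
      rw [segment_eq_image']
      exact ⟨x, ⟨h0.le, h1.le⟩, (hφreal x).symm⟩
    rcases hx with ⟨w, hw⟩ | hx
    · exact hends x h0 h1 w (D.vertex_mem w d (hw ▸ hseg)) hw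
    · obtain ⟨⟨d', hd'⟩, hx⟩ := mem_iUnion.1 hx
      obtain ⟨w, hw, -, hwx⟩ := D.edge_inter d d' hd'.symm _ hseg hx
      exact hends x h0 h1 w (Sym2.mem_iff.1 hw) hwx
  rw [openSegment_eq_image'] at hz
  obtain ⟨x₀, hx₀, rfl⟩ := hz
  simp only
  rw [← hφreal]
  -- `region_left` speaks of the midpoint only, so the left face is carried along the edge from `1 /
  -- 2` to `x₀`.
  let I : Set ℂ := segment ℝ (x₀ : ℂ) ((1 / 2 : ℝ) : ℂ)
  have hI : I ⊆ φ ⁻¹' Oᶜ := by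
    intro w hw
    simp only [I] at hw
    rw [segment_eq_image] at hw
    obtain ⟨θ, hθ, rfl⟩ := hw
    have hpt : (1 - θ) • (x₀ : ℂ) + θ • ((1 / 2 : ℝ) : ℂ) =
        (((1 - θ) * x₀ + θ * (1 / 2) : ℝ) : ℂ) := by
      simp
    simp only [hpt]
    have := convex_Ioo (0 : ℝ) 1 hx₀ (show (1 / 2 : ℝ) ∈ Ioo (0 : ℝ) 1 by norm_num)
      (sub_nonneg.2 hθ.2) hθ.1 (by ring)
    exact hφO _ this.1 this.2
  obtain ⟨ε, hε, hT⟩ := (isCompact_segment _ _).exists_thickening_subset_open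
    (hO.isOpen_compl.preimage hφc) hI
  -- The upper half of a thin neighbourhood is convex and misses the drawing, hence is in one face.
  let T : Set ℂ := Metric.thickening ε I ∩ {w | 0 < w.im}
  have hTconv : Convex ℝ T := ((convex_segment _ _).thickening ε).inter (convex_halfSpace_im_gt 0)
  have hTsub : φ '' T ⊆ (pointSet X D.pos)ᶜ := by
    rintro _ ⟨w, hw, rfl⟩ hmem
    have hwO : φ w ∉ O := hT hw.1
    rcases hmem with hmem | hmem
    · exact hwO (.inl hmem)
    · obtain ⟨d', hd'⟩ := mem_iUnion.1 hmem
      by_cases he : d'.edge = d.edge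
      · have hseg : φ w ∈ segment ℝ a b := by
          rcases (SimpleGraph.dart_edge_eq_iff _ _).1 he with rfl | rfl
          · exact hd'
          · rw [segment_symm]
            exact hd'
        rw [segment_eq_image'] at hseg
        obtain ⟨θ, -, hθ⟩ := hseg
        simp only at hθ
        rw [← hφreal] at hθ
        have := hφinj hθ
        have him : 0 < w.im := hw.2
        rw [← this, Complex.ofReal_im] at him
        exact lt_irrefl _ him
      · exact hwO (.inr (mem_iUnion.2 ⟨⟨d', he⟩, hd'⟩))
  have hmid : ∃ w ∈ T, φ w ∈ D.region (γ.left d) := by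
    have h1 := D.region_left d
    have h2 : ∀ᶠ e : ℝ in 𝓝[>] 0, e < ε := (eventually_lt_nhds hε).filter_mono nhdsWithin_le_nhds
    obtain ⟨e, he1, he2, he3⟩ := (h1.and (h2.and self_mem_nhdsWithin)).exists
    have he3 : 0 < e := he3
    refine ⟨((1 / 2 : ℝ) : ℂ) + e * Complex.I, ⟨?_, ?_⟩, ?_⟩
    · rw [Metric.mem_thickening_iff]
      refine ⟨_, right_mem_segment ℝ _ _, ?_⟩
      rw [dist_eq_norm, add_sub_cancel_left, norm_mul, Complex.norm_I, mul_one, Complex.norm_real,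
        Real.norm_eq_abs, abs_of_pos he3]
      exact he2
    · simpa using he3
    · rw [← ha, ← hb] at he1
      convert he1 using 1
      simp only [φ]
      push_cast
      ring
  obtain ⟨w, hwT, hw⟩ := hmid
  have hsub := D.subset_region (hTconv.isPreconnected.image φ hφc.continuousOn) hTsub ⟨w, hwT, rfl⟩ hw
  have hnhds : ∀ᶠ y in 𝓝 (φ x₀), (y - a) / (b - a) ∈ Metric.thickening ε I := by
    have hc : ContinuousAt (fun y => (y - a) / (b - a)) (φ x₀) := by fun_prop
    refine hc.eventually (Metric.isOpen_thickening.mem_nhds ?_)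
    have : (φ x₀ - a) / (b - a) = x₀ := hφinj (hφψ _)
    simp only [this]
    exact Metric.self_subset_thickening hε _ (left_mem_segment ℝ _ _)
  filter_upwards [hnhds] with y hy him
  exact hsub ⟨_, ⟨hy, him⟩, hφψ y⟩

theorem mem_closure_region [Finite V] (d : X.planarization.Dart) {z : ℂ}
    (hz : z ∈ openSegment ℝ (D.pos d.fst) (D.pos d.snd)) : z ∈ closure (D.region (γ.left d)) := by
  have hev := D.eventually_mem_region d hz
  have hab := D.pos_ne d
  rw [openSegment_eq_image'] at hz
  obtain ⟨x₀, hx₀, rfl⟩ := hz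
  set a := D.pos d.fst
  set b := D.pos d.snd
  have ht : Tendsto (fun e : ℝ => a + (x₀ + e * Complex.I) * (b - a)) (𝓝[>] 0)
      (𝓝 (a + x₀ • (b - a))) := by
    have hc : Continuous fun e : ℝ => a + (x₀ + e * Complex.I) * (b - a) := by fun_prop
    have := hc.tendsto 0
    simp only [Complex.ofReal_zero, zero_mul, add_zero] at this
    exact this.mono_left nhdsWithin_le_nhds
  refine mem_closure_of_tendsto ht ?_
  filter_upwards [ht.eventually hev, self_mem_nhdsWithin] with e he he0
  refine he ?_
  rw [add_sub_cancel_left, mul_div_assoc, div_self hab, mul_one]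
  simpa using he0

/-- In the coordinate in which `d` runs from `0` to `1`, the sign of the imaginary part tells left,
right and on the edge. -/
theorem eventually_mem [Finite V] (d : X.planarization.Dart) {z : ℂ}
    (hz : z ∈ openSegment ℝ (D.pos d.fst) (D.pos d.snd)) :
    ∀ᶠ y in 𝓝 z, y ∈ pointSet X D.pos ∨ y ∈ D.region (γ.left d) ∨
      y ∈ D.region (γ.left d.symm) := by
  have hab := D.pos_ne d
  have h1 := D.eventually_mem_region d hz
  have h2 := D.eventually_mem_region d.symm (z := z) (by rw [openSegment_symm]; exact hz)
  have h3 : ∀ᶠ y in 𝓝 z, ((y - D.pos d.fst) / (D.pos d.snd - D.pos d.fst)).re ∈ Ioo (0 : ℝ) 1 := by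
    have hc : ContinuousAt (fun y => ((y - D.pos d.fst) / (D.pos d.snd - D.pos d.fst)).re) z :=
      Complex.continuous_re.continuousAt.comp (by fun_prop)
    refine hc.eventually (isOpen_Ioo.mem_nhds ?_)
    rw [openSegment_eq_image'] at hz
    obtain ⟨x₀, hx₀, rfl⟩ := hz
    simp only [add_sub_cancel_left, Complex.real_smul, mul_div_assoc, div_self hab, mul_one,
      Complex.ofReal_re]
    exact hx₀
  filter_upwards [h1, h2, h3] with y hy1 hy2 hy3
  have hsymm : (y - D.pos d.symm.fst) / (D.pos d.symm.snd - D.pos d.symm.fst) =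
      1 - (y - D.pos d.fst) / (D.pos d.snd - D.pos d.fst) := by
    have hba : D.pos d.fst - D.pos d.snd ≠ 0 := sub_ne_zero.2 (sub_ne_zero.1 hab).symm
    change (y - D.pos d.snd) / (D.pos d.fst - D.pos d.snd) = _
    rw [eq_sub_iff_add_eq, ← neg_sub (D.pos d.fst) (D.pos d.snd), div_neg, ← sub_eq_add_neg,
      ← sub_div, sub_sub_sub_cancel_left, div_self hba]
  rcases lt_trichotomy ((y - D.pos d.fst) / (D.pos d.snd - D.pos d.fst)).im 0 with h | h | h
  · refine .inr (.inr (hy2 ?_))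
    rw [hsymm]
    simpa using h
  · refine .inl (D.segment_subset d ?_)
    rw [segment_eq_image']
    refine ⟨_, ⟨hy3.1.le, hy3.2.le⟩, ?_⟩
    have hw : ((((y - D.pos d.fst) / (D.pos d.snd - D.pos d.fst)).re : ℝ) : ℂ) =
        (y - D.pos d.fst) / (D.pos d.snd - D.pos d.fst) := Complex.ext rfl (by simp [h])
    simp only [Complex.real_smul]
    rw [hw, div_mul_cancel₀ _ hab, add_sub_cancel]
  · exact .inr (.inl (hy1 h))

/-- The outer face contains all points far away from the origin. -/
theorem exists_subset_outer [Finite V] :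
    ∃ R : ℝ, 0 < R ∧ {z : ℂ | R < ‖z‖} ⊆ D.region γ.outer := by
  obtain ⟨R, hR, hsub⟩ := D.isCompact_pointSet.isBounded.exists_pos_norm_le
  refine ⟨R, hR, ?_⟩
  have h1 : ∃ z ∈ D.region γ.outer, R < ‖z‖ := by
    by_contra! hcon
    exact D.outer_unbounded (isBounded_iff_forall_norm_le.2 ⟨R, hcon⟩)
  obtain ⟨z, hz, hzR⟩ := h1
  exact D.subset_region (isPreconnected_lt_norm hR) (fun w hw hw' => absurd (hsub w hw') (not_le.2 hw))
    hzR hz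

/-- A face that meets an open half-plane disjoint from the cycle is in the exterior. -/
theorem mem_exterior_of_halfPlane [Finite V] (C : CrossingCycle X) {m : ℂ} (hm : m ≠ 0) {k : ℝ}
    (hk : ∀ w, ¬ C.Off w → (m * D.pos w).re ≤ k) {f : γ.Face} {z : ℂ} (hz : z ∈ D.region f)
    (hzk : k < (m * z).re) : f ∈ γ.exterior C := by
  by_contra hf
  have := γ.finite_face
  -- Without the vertices, the half-plane is still connected and meets the drawing only inside
  -- edges, where just two faces come together.
  let M : Set ℂ := {z : ℂ | k < (m * z).re} \ range D.pos
  have hM : IsPreconnected M := isPreconnected_halfPlane_diff hm k (finite_range _).countable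
  let Z : Set γ.Face → Set ℂ := fun S => ⋃ g ∈ S, closure (D.region g)
  have hZ : ∀ S, IsClosed (Z S) := fun S =>
    (toFinite S).isClosed_biUnion fun _ _ => isClosed_closure
  have edge : ∀ y ∈ M, y ∈ pointSet X D.pos → ∃ d : X.planarization.Dart, d.edge ∉ C.edges ∧
      y ∈ openSegment ℝ (D.pos d.fst) (D.pos d.snd) := by
    rintro y ⟨hyk, hyr⟩ (hy | hy)
    · exact absurd hy hyr
    · obtain ⟨d, hd⟩ := mem_iUnion.1 hy
      refine ⟨d, fun hC => ?_, mem_openSegment_of_ne_left_right (fun h => hyr ⟨_, h⟩)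
        (fun h => hyr ⟨_, h⟩) hd⟩
      have h1 := hk d.fst fun h => C.not_mem_edges_of_off h hC
      have h2 := hk d.snd fun h => C.not_mem_edges_of_off_snd h hC
      obtain ⟨p, q, hp, hq, hpq, rfl⟩ := hd
      simp only [mem_ofPred_eq, mul_add, Complex.add_re, mul_smul_comm, Complex.smul_re,
        smul_eq_mul] at hyk
      have : p * (m * D.pos d.fst).re + q * (m * D.pos d.snd).re ≤ p * k + q * k :=
        add_le_add (mul_le_mul_of_nonneg_left h1 hp) (mul_le_mul_of_nonneg_left h2 hq)
      rw [← add_mul, hpq, one_mul] at this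
      linarith
  have hcover : M ⊆ Z (γ.exterior C) ∪ Z (γ.exterior C)ᶜ := by
    intro y hy
    have : ∃ g, y ∈ closure (D.region g) := by
      by_cases hp : y ∈ pointSet X D.pos
      · obtain ⟨d, -, hd⟩ := edge y hy hp
        exact ⟨_, D.mem_closure_region d hd⟩
      · obtain ⟨g, hg⟩ := D.region_surjective y hp
        exact ⟨g, subset_closure hg⟩
    obtain ⟨g, hg⟩ := this
    by_cases h : g ∈ γ.exterior C
    · exact .inl (mem_biUnion h hg)
    · exact .inr (mem_biUnion (show g ∈ (γ.exterior C)ᶜ from h) hg)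
  have hsubM : ∀ (g : γ.Face) (y : ℂ), y ∈ D.region g → k < (m * y).re → y ∈ M :=
    fun g y hy hyk => ⟨hyk, fun hr => D.region_subset g hy (.inl hr)⟩
  have hout : (M ∩ Z (γ.exterior C)).Nonempty := by
    obtain ⟨R, hR, hsub⟩ := D.exists_subset_outer
    -- Chosen so that `K / m` is in the half-plane and has norm above `R`, hence is in the outer
    -- face.
    let K : ℝ := |k| + R * ‖m‖ + 1
    have hm' : 0 < ‖m‖ := norm_pos_iff.2 hm
    have hK : 0 < K := by positivity
    have hmem : ((K : ℂ) / m) ∈ D.region γ.outer := by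
      apply hsub
      simp only [mem_ofPred_eq]
      rw [norm_div, Complex.norm_real, Real.norm_eq_abs, abs_of_pos hK, lt_div_iff₀ hm']
      simp only [K]
      linarith [abs_nonneg k]
    refine ⟨_, hsubM _ _ hmem ?_, mem_biUnion
      (show γ.outer ∈ γ.exterior C from Relation.ReflTransGen.refl) (subset_closure hmem)⟩
    rw [mul_div_cancel₀ _ hm, Complex.ofReal_re]
    simp only [K]
    have : 0 < R * ‖m‖ := by positivity
    linarith [le_abs_self k]
  have hin : (M ∩ Z (γ.exterior C)ᶜ).Nonempty :=
    ⟨z, hsubM f z hz hzk, mem_biUnion (show f ∈ (γ.exterior C)ᶜ from hf) (subset_closure hz)⟩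
  -- By connectedness an exterior and an interior face have a common closure point in `M`. It would
  -- have to be on a cycle edge, and these miss the half-plane.
  obtain ⟨y, hyM, hy1, hy2⟩ := isPreconnected_closed_iff.1 hM _ _ (hZ _) (hZ _) hcover hout hin
  obtain ⟨g, hg, hyg⟩ := mem_iUnion₂.1 hy1
  obtain ⟨g', hg', hyg'⟩ := mem_iUnion₂.1 hy2
  by_cases hp : y ∈ pointSet X D.pos
  · obtain ⟨d, hdC, hd⟩ := edge y hyM hp
    have hev := D.eventually_mem d hd
    have near : ∀ g, y ∈ closure (D.region g) → g = γ.left d ∨ g = γ.left d.symm := by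
      intro g hg
      obtain ⟨x, hx1, hx2⟩ := mem_closure_iff_nhds.1 hg _ hev
      rcases hx1 with h | h | h
      · exact absurd h (D.region_subset g hx2)
      · exact .inl (D.face_eq hx2 h)
      · exact .inr (D.face_eq hx2 h)
    have hsame : γ.left d ∈ γ.exterior C ↔ γ.left d.symm ∈ γ.exterior C := by
      rw [← side_eq_zero, ← side_eq_zero, γ.side_left_eq C hdC]
    have hg'' : g' ∉ γ.exterior C := hg'
    rcases near g hyg with rfl | rfl <;> rcases near g' hyg' with rfl | rfl <;> tauto
  · obtain ⟨h, hh⟩ := D.region_surjective y hp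
    have near : ∀ g, y ∈ closure (D.region g) → g = h := by
      intro g hg
      obtain ⟨x, hx1, hx2⟩ := mem_closure_iff.1 hg _ (D.isOpen_region h) hh
      exact D.face_eq hx2 hx1
    rw [near g hyg] at hg
    rw [near g' hyg'] at hg'
    exact hg' hg

/-- At a crossing `q` of the cycle outside the convex hull of the other vertices of the cycle, the
neighbours off the cycle are in the exterior. -/
theorem vertexExt_of_separated [Finite V] (C : CrossingCycle X) {m : ℂ} {q : X.Crossing}
    (hk : ∀ w, ¬ C.Off w → (m * D.pos w).re ≤ (m * D.pos (.inr q)).re) {u x : V}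
    (hux : s(u, x) ∈ q.1) (hu : (m * D.pos (.inl u)).re < (m * D.pos (.inr q)).re)
    (hx : C.Off (.inl x)) : γ.VertexExt C.edges (.inl x) := by
  have hm : m ≠ 0 := by
    rintro rfl
    simp at hu
  have hadj : X.planarization.Adj (.inr q) (.inl x) :=
    ⟨_, hux, Sym2.mem_mk_right _ _⟩
  let d : X.planarization.Dart := ⟨(.inr q, .inl x), hadj⟩
  have hst := D.straight q u x hux
  -- The edge from `u` is straight and passes `q`, so it goes on into the half-plane beyond `q`.
  have hxq : (m * D.pos (.inr q)).re < (m * D.pos (.inl x)).re := by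
    obtain ⟨a, b, ha, hb, hab, he⟩ := hst
    have h1 : (m * D.pos (.inr q)).re =
        a * (m * D.pos (.inl u)).re + b * (m * D.pos (.inl x)).re := by
      rw [← he]
      simp only [mul_add, Complex.add_re, mul_smul_comm, Complex.smul_re, smul_eq_mul]
    have ha' : a = 1 - b := by linarith
    rw [ha'] at h1
    nlinarith
  have hev : ∀ᶠ e : ℝ in 𝓝[>] 0, (m * D.pos (.inr q)).re <
      (m * ((D.pos d.fst + D.pos d.snd) / 2 +
        (e : ℂ) * (Complex.I * (D.pos d.snd - D.pos d.fst)))).re := by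
    have hc : Continuous fun e : ℝ => (m * ((D.pos d.fst + D.pos d.snd) / 2 +
        (e : ℂ) * (Complex.I * (D.pos d.snd - D.pos d.fst)))).re :=
      Complex.continuous_re.comp (by fun_prop)
    refine (hc.tendsto 0).mono_left nhdsWithin_le_nhds |>.eventually (lt_mem_nhds ?_)
    have : (m * ((D.pos d.fst + D.pos d.snd) / 2 +
        ((0 : ℝ) : ℂ) * (Complex.I * (D.pos d.snd - D.pos d.fst)))).re =
        ((m * D.pos (.inr q)).re + (m * D.pos (.inl x)).re) / 2 := by
      have h2 : m * ((D.pos d.fst + D.pos d.snd) / 2 +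
          ((0 : ℝ) : ℂ) * (Complex.I * (D.pos d.snd - D.pos d.fst))) =
          ((1 / 2 : ℝ) : ℂ) * (m * D.pos (.inr q) + m * D.pos (.inl x)) := by
        simp only [d]
        push_cast
        ring
      rw [h2, Complex.re_ofReal_mul, Complex.add_re]
      ring
    rw [this]
    linarith
  obtain ⟨e, he1, he2⟩ := ((D.region_left d).and hev).exists
  have hext := D.mem_exterior_of_halfPlane C hm hk he1 he2
  rw [vertexExt_iff]
  exact ⟨hx, onSide_of_incident hx (γ.incident_left_snd d) ((γ.side_eq_zero C).2 hext)⟩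

/-- Otherwise a line separates `q` from the other three vertices. Either an edge `uv` passes `q`,
which is then on the segment `uv`, or the edge from `u` goes on beyond `q` to a vertex in the
exterior, whereas a posi-cycle has that vertex in the interior. -/
theorem mem_convexHull_of_isGood [Finite V] {C : CrossingCycle X} (h : γ.IsGood C 1)
    {q q' : X.Crossing} (hq : q = C.c ∧ q' = C.s ∨ q = C.s ∧ q' = C.c) :
    D.pos (.inr q) ∈ convexHull ℝ {D.pos (.inr q'), D.pos (.inl C.u), D.pos (.inl C.v)} := by
  by_contra hnot
  obtain ⟨m, hm⟩ := exists_separating (by simp) hnot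
  have hu := hm (D.pos (.inl C.u)) (by simp)
  have hv := hm (D.pos (.inl C.v)) (by simp)
  have hq' := hm (D.pos (.inr q')) (by simp)
  have hqC : q = C.c ∨ q = C.s := hq.imp And.left And.left
  have hk : ∀ w, ¬ C.Off w → (m * D.pos w).re ≤ (m * D.pos (.inr q)).re := by
    intro w hw
    have : w = .inl C.u ∨ w = .inl C.v ∨ w = .inr q ∨ w = .inr q' := by
      rw [C.off_iff] at hw
      rcases hq with ⟨rfl, rfl⟩ | ⟨rfl, rfl⟩ <;> tauto
    rcases this with rfl | rfl | rfl | rfl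
    · exact hu.le
    · exact hv.le
    · exact le_rfl
    · exact hq'.le
  have huq : X.planarization.Adj (.inl C.u) (.inr q) := by
    rcases hqC with rfl | rfl
    · exact C.adj_uc
    · exact C.adj_su.symm
  have hvq : X.planarization.Adj (.inl C.v) (.inr q) := by
    rcases hqC with rfl | rfl
    · exact C.adj_cv.symm
    · exact C.adj_vs
  rcases crossing_cases C.u_ne_v huq hvq with huv | ⟨x, y, hxy⟩
  · refine hnot ?_
    have h1 := openSegment_subset_segment ℝ _ _ (D.straight q _ _ huv)
    exact segment_subset_convexHull (by simp) (by simp) h1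
  · have hint := (h.vertexInt hqC hxy).1
    rw [vertexInt_iff] at hint
    have hext := D.vertexExt_of_separated C hk ((mem_of_eq hxy _).2 (.inl rfl)) hu hint.1
    rw [vertexExt_iff] at hext
    exact absurd (hext.2.unique hint.2) (by decide)

/-- Both crossings are on the segment `uv`, so one of them is on the segment from `u` to the other.
That segment is an edge of the planarization and contains no vertex but its ends. -/
theorem not_isPosi [Finite V] (D : γ.StraightLineDrawing) (C : CrossingCycle X) : ¬ γ.IsPosi C := by
  intro h
  rw [isPosi_iff] at h
  have hc := D.mem_convexHull_of_isGood h (.inl ⟨rfl, rfl⟩)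
  have hs := D.mem_convexHull_of_isGood h (.inr ⟨rfl, rfl⟩)
  have hne : D.pos (.inr C.c) ≠ D.pos (.inr C.s) := fun h =>
    C.c_ne_s (Sum.inr_injective (D.pos_injective h))
  rcases mem_segment_or_mem_segment (mem_segment_of_mem_convexHull hne hc hs)
    (mem_segment_of_mem_convexHull hne.symm hs hc) with h | h
  · rcases D.vertex_mem (.inr C.c) ⟨(_, _), C.adj_su.symm⟩ h with h | h
    · cases h
    · exact C.c_ne_s (Sum.inr_injective h)
  · rcases D.vertex_mem (.inr C.s) ⟨(_, _), C.adj_uc⟩ h with h | h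
    · cases h
    · exact C.c_ne_s (Sum.inr_injective h).symm

end OnePlaneEmbedding.StraightLineDrawing

end OnePlane

theorem lemma4 {V : Type*} [Finite V] (G : SimpleGraph V) (X : OnePlane.CrossingSystem G)
    (hX : X.IsCircular) (γ : OnePlane.OnePlaneEmbedding X) :
    (∀ γ' : OnePlane.OnePlaneEmbedding X,
      ∀ (C : OnePlane.CrossingCycle X) (z : V), γ.IsInFactor C z →
        (γ'.IsPosi C ↔ γ'.VertexExt C.edges (.inl z)) ∧
        (γ'.IsNega C ↔ γ'.VertexInt C.edges (.inl z))) ∧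
    (∀ C C' : OnePlane.CrossingCycle X, γ.IsForbiddenPair C C' →
      (∀ γ' : OnePlane.OnePlaneEmbedding X,
        (γ'.IsPosi C ∨ γ'.IsPosi C') ∧ (γ'.HasBConfiguration ∨ γ'.HasWConfiguration)) ∧
      ¬ ∃ γ' : OnePlane.OnePlaneEmbedding X, γ'.IsSLD) := by
  refine ⟨fun γ' C z hz => ⟨OnePlane.OnePlaneEmbedding.isPosi_iff_vertexExt hX hz γ',
    OnePlane.OnePlaneEmbedding.isNega_iff_vertexInt hX hz γ'⟩, fun C C' h => ⟨fun γ' => ?_, ?_⟩⟩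
  · have hp := h.isPosi_or_isPosi hX γ'
    exact ⟨hp, hp.elim (·.hasConfiguration) (·.hasConfiguration)⟩
  · rintro ⟨γ', ⟨D⟩⟩
    rcases h.isPosi_or_isPosi hX γ' with hp | hp
    · exact D.not_isPosi C hp
    · exact D.not_isPosi C' hp
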